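/- \textbf{Setting.} Let $p$ be an odd prime, $m_1<m_2<m_3<\cdots$ positive integers, and let $T$ be the rooted tree in which every vertex at level $i-1$ has $p^{m_i}$ children ($i\ge 1$), labelled $1,\dots,p^{m_i}$. Write $T_n$ for the subtree rooted at a vertex of level $n$. For $k\ge 1$ let $\psi_k$ be the map sending an automorphism of $T_n$ that fixes every vertex of the $k$-th layer of $T_n$ to the tuple of its sections at these vertices. Let $\mathbf e=(e_1,\dots,e_{p^{m_1}-1})$ be a nonzero vector with entries in $\{0,\pm1,\dots,\pm(p^{m_2}-1)\}$. For $n\ge 0$ let $a_n$ be the rooted automorphism of $T_n$ corresponding to the cycle $(1\,2\cdots p^{m_{n+1}})$, and define automorphisms $b_n$ of $T_n$ recursively by \[ \psi_1(b_n)=(a_{n+1}^{e_1},\dots,a_{n+1}^{e_{p^{m_1}-1}},1,\dots,1,b_{n+1}) \] with $p^{m_{n+1}}-p^{m_1}$ entries $1$. Put $G_n=\langle a_n,b_n\rangle$; the group $G=G_0$ is the growing GGS-group defined by $\mathbf e$. Write $G_n'=[G_n,G_n]$, $\gamma_3(G_n)=[G_n',G_n]$, $\langle x\rangle^{G_n}$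 for the subgroup generated by the $G_n$-conjugates of $x$, $\mathrm{St}_{G_n}(1)$ for the stabiliser in $G_n$ of the first layer of $T_n$, and $\mathrm{Rist}_G(n)$ for the product of the rigid stabilisers in $G$ of the vertices of level $n$. The group $G$ is \emph{branch} if it acts transitively on every layer of $T$ and $\mathrm{Rist}_G(n)$ has finite index in $G$ for all $n$. \textbf{Theorem.} \begin{enumerate} \item Suppose that $\psi_1(\gamma_3(G_{n-1}))\ge \gamma_3(G_n)\times\overset{p^{m_n}}{\cdots}\times\gamma_3(G_n)$ for all $n\ge1$. Then for all $n\ge 1$ \[ \psi_n(\mathrm{Rist}_G(n))\ \ge\ \langle b_n^{\,p^{m_{n+1}}}\rangle^{G_n}\gamma_3(G_n)\times\overset{p^{m_1+\cdots+m_n}}{\cdots}\times\langle b_n^{\,p^{m_{n+1}}}\rangle^{G_n}\gamma_3(G_n), \] and $G$ is branch. \item Suppose that $\psi_1(G_{n-1}')\ge G_n'\times\overset{p^{m_n}}{\cdots}\times G_n'$ for all $n\ge1$. Then for all $n\ge 1$ \[ \psi_n(\mathrm{Rist}_G(n))\ \ge\ \langle b_n^{\,p^{m_{n+1}}}\rangle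 G_n'\times\overset{p^{m_1+\cdots+m_n}}{\cdots}\times\langle b_n^{\,p^{m_{n+1}}}\rangle G_n'. \] \item Suppose that $\mathbf e$ is nonzero modulo $p$ and satisfies the torsion-type condition \[ \sum_{k=1}^{p^{m_1-i}-1}e_{kp^i}\equiv 0 \pmod{p^{i+1}}\qquad\text{for all } i\in\{0,\dots,m_1-1\}. \] Then $\psi_1(\gamma_3(\mathrm{St}_{G_{n-1}}(1)))=\gamma_3(G_n)\times\overset{p^{m_n}}{\cdots}\times\gamma_3(G_n)$ for all $n\ge1$. In particular the hypothesis of (1) holds, so $G$ is branch. \end{enumerate} -/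

import Mathlib

namespace GrowingGGS

/-- Fix a branching sequence `d 0, d 1, …` of a spherically homogeneous rooted tree `T`, where the
vertices at level `i` have `d i` children, and let `T_n` be the subtree rooted at a generic vertex
of level `n`.  `Vertex d n k` is the set of vertices of `T_n` which lie at level `k` of `T` (so at
distance `k - n` from the root of `T_n`): words `x_n x_{n+1} ⋯ x_{k-1}` with `x_i` in the alphabet
`Fin (d i)`.  In particular `Vertex d 0 k` is the `k`-th layer of `T`. -/
inductive Vertex (d : ℕ → ℕ) : ℕ → ℕ → Type
  | nil (n : ℕ) : Vertex d n n
  | cons {n k : ℕ} (x : Fin (d n)) (v : Vertex d (n + 1) k) : Vertex d n k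

variable {d : ℕ → ℕ}

namespace Vertex

/-- Concatenation of words. -/
def append : {n k l : ℕ} → Vertex d n k → Vertex d k l → Vertex d n l
  | _, _, _, .nil _, w => w
  | _, _, _, .cons x v, w => .cons x (append v w)

/-- `u.IsPrefix w`: the word `u` is a prefix of `w`, i.e. `w` lies in the subtree rooted at `u`. -/
def IsPrefix {n k l : ℕ} (u : Vertex d n k) (w : Vertex d n l) : Prop :=
  ∃ v : Vertex d k l, w = u.append v

theorem append_left_cancel {n k : ℕ} (u : Vertex d n k) :
    ∀ {l : ℕ} {v w : Vertex d k l}, u.append v = u.append w → v = w := by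
  induction u with
  | nil n => intro l v w h; exact h
  | cons x u ih =>
    intro l v w h
    simp only [append, cons.injEq, true_and] at h
    exact ih h

theorem append_assoc {n k : ℕ} (u : Vertex d n k) :
    ∀ {l j : ℕ} (v : Vertex d k l) (w : Vertex d l j),
      (u.append v).append w = u.append (v.append w) := by
  induction u with
  | nil n => intros; rfl
  | cons x u ih => intro l j v w; simp only [append]; rw [ih]

theorem append_isPrefix_append {n k l j : ℕ} (u : Vertex d n k) (v : Vertex d k l)
    (w : Vertex d k j) : (u.append v).IsPrefix (u.append w) ↔ v.IsPrefix w := by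
  constructor
  · rintro ⟨t, ht⟩
    rw [append_assoc] at ht
    exact ⟨t, append_left_cancel u ht⟩
  · rintro ⟨t, rfl⟩
    exact ⟨t, (append_assoc u v t).symm⟩

end Vertex

/-- The group `Aut T_n` of automorphisms of the rooted tree `T_n`: the permutations of the vertices
which preserve each layer and the relation "is a prefix of". -/
def treeAut (d : ℕ → ℕ) (n : ℕ) : Subgroup (∀ k, Equiv.Perm (Vertex d n k)) where
  carrier := {f | ∀ (k l : ℕ) (u : Vertex d n k) (w : Vertex d n l),
    (f k u).IsPrefix (f l w) ↔ u.IsPrefix w}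
  one_mem' := fun _ _ _ _ => Iff.rfl
  mul_mem' := by
    intro f g hf hg k l u w
    exact (hf k l (g k u) (g l w)).trans (hg k l u w)
  inv_mem' := by
    intro f hf k l u w
    have h := hf k l ((f k)⁻¹ u) ((f l)⁻¹ w)
    rw [← Equiv.Perm.mul_apply, mul_inv_cancel, ← Equiv.Perm.mul_apply, mul_inv_cancel] at h
    exact h.symm

theorem exists_section {n k l : ℕ} (f : treeAut d n) (u : Vertex d n k) (v : Vertex d k l) :
    ∃ v' : Vertex d k l, f.1 l (u.append v) = (f.1 k u).append v' :=
  (f.2 k l u (u.append v)).2 ⟨v, rfl⟩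

/-- The action of the section of `f` at the vertex `u`: the word `v` is sent to the unique word
`v'` with `f (u v) = f (u) v'`. -/
noncomputable def sectionFun {n k : ℕ} (f : treeAut d n) (u : Vertex d n k) (l : ℕ)
    (v : Vertex d k l) : Vertex d k l :=
  (exists_section f u v).choose

theorem sectionFun_spec {n k l : ℕ} (f : treeAut d n) (u : Vertex d n k) (v : Vertex d k l) :
    f.1 l (u.append v) = (f.1 k u).append (sectionFun f u l v) :=
  (exists_section f u v).choose_spec

theorem sectionFun_bijective {n k : ℕ} (f : treeAut d n) (u : Vertex d n k) (l : ℕ) :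
    Function.Bijective (sectionFun f u l) := by
  constructor
  · intro v w h
    refine Vertex.append_left_cancel u ((f.1 l).injective ?_)
    rw [sectionFun_spec, sectionFun_spec, h]
  · intro v'
    have h := f.2 k l u ((f.1 l)⁻¹ ((f.1 k u).append v'))
    rw [← Equiv.Perm.mul_apply, mul_inv_cancel, Equiv.Perm.one_apply] at h
    obtain ⟨v, hv⟩ := h.1 ⟨v', rfl⟩
    refine ⟨v, Vertex.append_left_cancel (f.1 k u) ?_⟩
    rw [← sectionFun_spec, ← hv, ← Equiv.Perm.mul_apply, mul_inv_cancel, Equiv.Perm.one_apply]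

/-- The section `f_u` of `f` at a vertex `u` of level `k`, an automorphism of `T_k`. -/
noncomputable def sectionAt {n k : ℕ} (f : treeAut d n) (u : Vertex d n k) : treeAut d k :=
  ⟨fun l => Equiv.ofBijective (sectionFun f u l) (sectionFun_bijective f u l), by
    intro l j v w
    simp only [Equiv.ofBijective_apply]
    rw [← Vertex.append_isPrefix_append (f.1 k u), ← sectionFun_spec, ← sectionFun_spec, f.2,
      Vertex.append_isPrefix_append]⟩

theorem sectionAt_spec {n k l : ℕ} (f : treeAut d n) (u : Vertex d n k) (v : Vertex d k l) :
    f.1 l (u.append v) = (f.1 k u).append ((sectionAt f u).1 l v) :=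
  sectionFun_spec f u v

theorem sectionAt_ext {n k : ℕ} {f : treeAut d n} {u : Vertex d n k} {g : treeAut d k}
    (h : ∀ (l : ℕ) (v : Vertex d k l), f.1 l (u.append v) = (f.1 k u).append (g.1 l v)) :
    sectionAt f u = g := by
  refine Subtype.ext (funext fun l => Equiv.ext fun v => ?_)
  exact Vertex.append_left_cancel (f.1 k u) ((sectionAt_spec f u v).symm.trans (h l v))

/-- The stabiliser in `Aut T_n` of all vertices at level `k`. -/
def levelStab (d : ℕ → ℕ) (n k : ℕ) : Subgroup (treeAut d n) where
  carrier := {f | ∀ v : Vertex d n k, f.1 k v = v}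
  one_mem' := fun _ => rfl
  mul_mem' := by
    intro f g hf hg v
    exact (congrArg (f.1 k) (hg v)).trans (hf v)
  inv_mem' := by
    intro f hf v
    exact (Equiv.Perm.inv_eq_iff_eq).2 (hf v).symm

/-- The decomposition `ψ` of the elements of the stabiliser of level `k` into their sections at the
vertices of level `k`, with values in the direct product of copies of `Aut T_k` indexed by these
vertices. -/
noncomputable def psi (d : ℕ → ℕ) (n k : ℕ) :
    levelStab d n k →* (Vertex d n k → treeAut d k) where
  toFun f u := sectionAt f.1 u
  map_one' := funext fun u => sectionAt_ext fun _ _ => rfl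
  map_mul' := by
    intro f g
    refine funext fun u => sectionAt_ext fun l v => ?_
    have hg : g.1.1 k u = u := g.2 u
    have h1 : (f * g).1.1 k u = f.1.1 k (g.1.1 k u) := rfl
    have h2 : (f * g).1.1 l (u.append v) = f.1.1 l (g.1.1 l (u.append v)) := rfl
    rw [h1, h2, sectionAt_spec g.1 u v, hg, sectionAt_spec f.1 u]
    rfl

/-- The image `ψ (H)` of a subgroup `H` of `Aut T_n` that stabilises level `k`
(for any other subgroup `H`, the image of the elements of `H` that stabilise level `k`). -/
noncomputable def psiImage {n : ℕ} (H : Subgroup (treeAut d n)) (k : ℕ) :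
    Subgroup (Vertex d n k → treeAut d k) :=
  (H.subgroupOf (levelStab d n k)).map (psi d n k)

/-- The direct product of copies of `K`, one for each vertex of level `k` of `T_n`. -/
def levelProd (n : ℕ) {k : ℕ} (K : Subgroup (treeAut d k)) :
    Subgroup (Vertex d n k → treeAut d k) :=
  Subgroup.pi Set.univ fun _ => K

/-- The rigid vertex stabiliser of `u` in `G`: the elements of `G` that fix all vertices which do
not have `u` as a prefix. -/
def rigidStab {n k : ℕ} (G : Subgroup (treeAut d n)) (u : Vertex d n k) :
    Subgroup (treeAut d n) where
  carrier := {f | f ∈ G ∧ ∀ (l : ℕ) (v : Vertex d n l), ¬ u.IsPrefix v → f.1 l v = v}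
  one_mem' := ⟨G.one_mem, fun _ _ _ => rfl⟩
  mul_mem' := by
    rintro f g ⟨hfG, hf⟩ ⟨hgG, hg⟩
    exact ⟨G.mul_mem hfG hgG, fun l v hv => (congrArg (f.1 l) (hg l v hv)).trans (hf l v hv)⟩
  inv_mem' := by
    rintro f ⟨hfG, hf⟩
    exact ⟨G.inv_mem hfG, fun l v hv => (Equiv.Perm.inv_eq_iff_eq).2 (hf l v hv).symm⟩

/-- The rigid stabiliser in `G` of level `k`: the product of the rigid stabilisers in `G` of the
vertices of level `k`. -/
def rigidLevelStab {n : ℕ} (G : Subgroup (treeAut d n)) (k : ℕ) : Subgroup (treeAut d n) :=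
  ⨆ u : Vertex d n k, rigidStab G u

/-- `G` acts transitively on every layer of the tree `T_n`. -/
def SphericallyTransitive {n : ℕ} (G : Subgroup (treeAut d n)) : Prop :=
  ∀ (k : ℕ) (u v : Vertex d n k), ∃ g ∈ G, g.1 k u = v

/-- `G` is a branch group: it acts spherically transitively and all its rigid level stabilisers are
of finite index in `G` (the layers of `T_n` are the levels `k ≥ n` of `T`). -/
def IsBranch {n : ℕ} (G : Subgroup (treeAut d n)) : Prop :=
  SphericallyTransitive G ∧ ∀ k, n ≤ k → ((rigidLevelStab G k).subgroupOf G).FiniteIndex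

/-- The action of the rooted automorphism of `T_n` with label `σ` at the root. -/
def rootedFun {n : ℕ} (σ : Equiv.Perm (Fin (d n))) : {k : ℕ} → Vertex d n k → Vertex d n k
  | _, .nil _ => .nil _
  | _, .cons x v => .cons (σ x) v

theorem rootedFun_mul {n k : ℕ} (σ τ : Equiv.Perm (Fin (d n))) (v : Vertex d n k) :
    rootedFun (σ * τ) v = rootedFun σ (rootedFun τ v) := by
  cases v <;> rfl

theorem rootedFun_one {n k : ℕ} (v : Vertex d n k) :
    rootedFun (1 : Equiv.Perm (Fin (d n))) v = v := by
  cases v <;> rfl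

theorem rootedFun_isPrefix {n k l : ℕ} (σ : Equiv.Perm (Fin (d n))) {u : Vertex d n k}
    {w : Vertex d n l} (h : u.IsPrefix w) : (rootedFun σ u).IsPrefix (rootedFun σ w) := by
  obtain ⟨v, rfl⟩ := h
  cases u with
  | nil => exact ⟨rootedFun σ v, rfl⟩
  | cons x u => exact ⟨v, rfl⟩

/-- The rooted automorphism of `T_n` with label `σ` at the root. -/
def rooted {n : ℕ} (σ : Equiv.Perm (Fin (d n))) : treeAut d n :=
  ⟨fun _ =>
    { toFun := rootedFun σ
      invFun := rootedFun σ⁻¹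
      left_inv := fun v => by rw [← rootedFun_mul, inv_mul_cancel, rootedFun_one]
      right_inv := fun v => by rw [← rootedFun_mul, mul_inv_cancel, rootedFun_one] }, by
    intro k l u w
    refine ⟨fun h => ?_, rootedFun_isPrefix σ⟩
    have h' := rootedFun_isPrefix σ⁻¹ h
    simpa only [Equiv.coe_fn_mk, ← rootedFun_mul, inv_mul_cancel, rootedFun_one] using h'⟩

/-- `a_n`: the rooted automorphism of `T_n` corresponding to the cycle `(1 2 ⋯ N)`, `N = d n`
(the letter `i` is the element `i - 1` of `Fin N`). -/
def genA (d : ℕ → ℕ) (n : ℕ) : treeAut d n :=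
  rooted (finRotate (d n))

/-- The label at the root of the section of `b_n` at the `j`-th vertex of the first layer of `T_n`,
`1 ≤ j < d n`: the power with exponent `e j` of the cycle `(1 2 ⋯ N)`, `N = d (n + 1)`, if
`j < d 0`, and the identity if `d 0 ≤ j`. -/
def dirLabel (d : ℕ → ℕ) (e : ℕ → ℤ) (n j : ℕ) : Equiv.Perm (Fin (d (n + 1))) :=
  if j < d 0 then finRotate (d (n + 1)) ^ e j else 1

/-- The action of the directed automorphism `b_n` of `T_n`, see `genB`. -/
def dirFun (e : ℕ → ℤ) : {n k : ℕ} → Vertex d n k → Vertex d n k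
  | _, _, .nil _ => .nil _
  | n, _, .cons x v =>
      .cons x (if x.val + 1 = d n then dirFun e v else rootedFun (dirLabel d e n (x.val + 1)) v)

theorem dirLabel_mul_neg (e : ℕ → ℤ) (n j : ℕ) :
    dirLabel d e n j * dirLabel d (fun i => -e i) n j = 1 := by
  unfold dirLabel
  split_ifs <;> simp

theorem dirFun_dirFun_neg (e : ℕ → ℤ) {n k : ℕ} (v : Vertex d n k) :
    dirFun e (dirFun (fun i => -e i) v) = v := by
  induction v with
  | nil n => rfl
  | cons x v ih =>
    simp only [dirFun]
    split_ifs with h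
    · rw [ih]
    · rw [← rootedFun_mul, dirLabel_mul_neg, rootedFun_one]

theorem dirFun_isPrefix (e : ℕ → ℤ) {n k l : ℕ} {u : Vertex d n k} {w : Vertex d n l}
    (h : u.IsPrefix w) : (dirFun e u).IsPrefix (dirFun e w) := by
  obtain ⟨v, rfl⟩ := h
  induction u with
  | nil => exact ⟨dirFun e v, rfl⟩
  | cons x u ih =>
    simp only [Vertex.append, dirFun]
    split_ifs with hx
    · obtain ⟨t, ht⟩ := ih v
      exact ⟨t, by rw [ht]; rfl⟩
    · obtain ⟨t, ht⟩ := rootedFun_isPrefix (dirLabel d e _ (x.val + 1))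
        (⟨v, rfl⟩ : u.IsPrefix (u.append v))
      exact ⟨t, by rw [ht]; rfl⟩

theorem dirFun_neg_dirFun (e : ℕ → ℤ) {n k : ℕ} (v : Vertex d n k) :
    dirFun (fun i => -e i) (dirFun e v) = v := by
  simpa only [neg_neg] using dirFun_dirFun_neg (fun i => -e i) v

/-- `b_n`: the directed automorphism of `T_n` that stabilises the first layer of `T_n` and whose
sections there are `a_{n+1} ^ e 1, …, a_{n+1} ^ e (d 0 - 1), 1, …, 1, b_{n+1}`.  Only the entries
`e 1, …, e (d 0 - 1)` of `e` are used. -/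
def genB (d : ℕ → ℕ) (e : ℕ → ℤ) (n : ℕ) : treeAut d n :=
  ⟨fun _ =>
    { toFun := dirFun e
      invFun := dirFun (fun i => -e i)
      left_inv := dirFun_neg_dirFun e
      right_inv := dirFun_dirFun_neg e }, by
    intro k l u w
    refine ⟨fun h => ?_, dirFun_isPrefix e⟩
    have h' := dirFun_isPrefix (fun i => -e i) h
    simpa only [Equiv.coe_fn_mk, dirFun_neg_dirFun] using h'⟩

/-- The group `G_n` generated by `a_n` and `b_n`. -/
def ggs (d : ℕ → ℕ) (e : ℕ → ℤ) (n : ℕ) : Subgroup (treeAut d n) :=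
  Subgroup.closure {genA d n, genB d e n}

/-- The branching sequence `p ^ m 1, p ^ m 2, …`, numbered from `0`. -/
def pTree (p : ℕ) (m : ℕ → ℕ) : ℕ → ℕ := fun i => p ^ m (i + 1)

/-- For the growing GGS-group `G = G_0` with parameters `p`, `m`, `e`: its `n`-th shifted group
`G_n = ⟨a_n, b_n⟩`, acting on the tree `T_n` with branching sequence `p ^ m (n + 1), …`. -/
def growingGGS (p : ℕ) (m : ℕ → ℕ) (e : ℕ → ℤ) (n : ℕ) : Subgroup (treeAut (pTree p m) n) :=
  ggs (pTree p m) e n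

/-- The standing assumptions on the parameters of a growing GGS-group: `p` is an odd prime,
`m 1 < m 2 < ⋯` are positive integers, and `(e 1, …, e (p ^ m 1 - 1))` is a nonzero vector with
entries in `{0, ±1, …, ±(p ^ m 2 - 1)}`.  (The values `m 0`, `e 0` and `e j` for `j ≥ p ^ m 1` play
no role.) -/
structure IsDefiningData (p : ℕ) (m : ℕ → ℕ) (e : ℕ → ℤ) : Prop where
  prime : p.Prime
  odd : p ≠ 2
  pos : 1 ≤ m 1
  increasing : ∀ i, 1 ≤ i → m i < m (i + 1)
  bound : ∀ j, 1 ≤ j → j ≤ p ^ m 1 - 1 → |e j| ≤ (p : ℤ) ^ m 2 - 1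
  ne_zero : ∃ j, 1 ≤ j ∧ j ≤ p ^ m 1 - 1 ∧ e j ≠ 0

/-- The defining vector is non-zero modulo `p`. -/
def NonzeroModP (p : ℕ) (m : ℕ → ℕ) (e : ℕ → ℤ) : Prop :=
  ∃ j, 1 ≤ j ∧ j ≤ p ^ m 1 - 1 ∧ ¬ e j ≡ 0 [ZMOD p]

/-- The torsion-type condition on the defining vector. -/
def TorsionType (p : ℕ) (m : ℕ → ℕ) (e : ℕ → ℤ) : Prop :=
  ∀ i, i < m 1 →
    (∑ k ∈ Finset.Icc 1 (p ^ (m 1 - i) - 1), e (k * p ^ i)) ≡ 0 [ZMOD (p : ℤ) ^ (i + 1)]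

/-- The third term `[[H, H], H]` of the lower central series of a subgroup `H`. -/
def gamma3 {Γ : Type*} [Group Γ] (H : Subgroup Γ) : Subgroup Γ := ⁅⁅H, H⁆, H⁆

/-- The normal closure `⟨x⟩ ^ H`: the subgroup generated by the conjugates of `x` under `H`. -/
def normalClosureIn {Γ : Type*} [Group Γ] (H : Subgroup Γ) (x : Γ) : Subgroup Γ :=
  Subgroup.closure {y | ∃ h ∈ H, y = h * x * h⁻¹}

end GrowingGGS

/-!
# Branch structures in growing GGS-groups

**The torsion-type condition.** Write `α = a_{n+1}`, `β = b_{n+1}`, `A = ⟨α, β⟩`. Conjugating `b_n`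
by the powers of `a_n` shows that `ψ₁` maps the first layer stabiliser onto the group `M` generated
by the tuples `b i` (`dirTuple`), indexed by the cyclic group of letters, with `β` at `i` and
`α ^ e j` at `i + j`. The core of the proof, `gamma3_dirGroup`, is that `γ₃(M)` is the full direct
product of the copies of `γ₃(A)`, provided that some `e j` is prime to `p` and `∑ e j ≡ 0` modulo
`p`.

As powers of `α` commute, `⁅b i, b (i + j)⁆` has at most two non-trivial entries, at `i` and `i + j`.
Commutators of such pairs that overlap in one position show that `γ₃(M)` contains `A''` at each
coordinate (`mulSingle_commutator_mem`), so that `(A')^ι / γ₃(M)` is abelian and acted on by `M`. If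
`e j` is prime to `p`, commutators of pairs with elements of `M` show that `γ₃(A)` has the same image
`E` in this quotient at `i` and at `i - j` (`exists_mulSingle_inv_mul_mem`); hence this image only
depends on the coset of `i` modulo the subgroup `C` generated by all such `j`. Now `M` acts on `E`
through any of the coordinates of the coset, so the action `x k` of `b k` equals `z i ^ e (i - k)`
for all `i ≠ k`, where `z i` is the action of `α` at `i`. Such a system with `x` non-trivial forces
`e` to be a non-zero constant modulo `p` on `C \ {0}`, contradicting `∑ e j ≡ 0`
(`eq_one_of_exponent_system`). So `M` acts trivially on `E`, and `E` is generated by the classes of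
`⁅⁅α, β⁆, h⁆`. The pair commutators compare these classes at different coordinates, and they satisfy
a system of the same shape, so that they vanish as well (`map_gamma3_eq_one`).

**Branching.** If branching holds at the first level then `e` is non-zero modulo `p`: otherwise the
sections of elements of `G_0` lie in a proper subgroup (`residueSubgroup`) that does not contain
`γ₃(G_1)`. It follows that `G_0` moves every vertex of level `n` to every other one with an arbitrary
element of `G_n` as section (`exists_mem_apply`). The hypotheses can be iterated over the levels
(`levelProd_le_psiImage`), and `b_0 ^ p ^ m (n + 1)` has `b_n ^ p ^ m (n + 1)` as its only non-trivial
section at level `n`; its conjugates give the remaining elements of the rigid stabilisers. Finally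
the quotient of `G_n` by `⟨b_n ^ p ^ m (n + 1)⟩ ^ G_n γ₃(G_n)` is nilpotent of class at most two and
generated by two elements of finite order, hence finite, which makes `G_0` a branch group.
-/

namespace GrowingGGS

open scoped commutatorElement

/-! ### A rigid system of equations over a finite `p`-group -/

/-- If the system `X k = ε (i - k) * Z i` (`i ≠ k`) over a finite `p`-group `C` has a solution in
`ZMod p` with `X` non-zero, then `Z`, hence `ε` away from `0`, is a non-zero constant; so the values
of `ε` have sum `(|C| - 1) ε ≠ 0`. -/
theorem sum_ne_zero_of_scalar_system {p : ℕ} [Fact p.Prime] {C : Type*} [AddCommGroup C] [Fintype C]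
    [DecidableEq C] {s : ℕ} (hcard : Fintype.card C = p ^ s) (hC : 3 ≤ Fintype.card C)
    (ε X Z : C → ZMod p) (hXZ : ∀ i k, i ≠ k → X k = ε (i - k) * Z i) {k₀ : C} (hk₀ : X k₀ ≠ 0) :
    ∑ j ∈ Finset.univ.erase 0, ε j ≠ 0 := by
  have hthird : ∀ k l : C, ∃ i, i ≠ k ∧ i ≠ l := by
    intro k l
    obtain ⟨i, -, hi⟩ := Finset.exists_mem_notMem_of_card_lt_card
      (show ({k, l} : Finset C).card < (Finset.univ : Finset C).card from
        lt_of_le_of_lt Finset.card_le_two (by rw [Finset.card_univ]; omega))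
    simp only [Finset.mem_insert, Finset.mem_singleton, not_or] at hi
    exact ⟨i, hi⟩
  have hX : ∀ k, X k ≠ 0 := by
    intro k
    obtain ⟨i, hik, hik₀⟩ := hthird k k₀
    rw [hXZ i k hik]
    refine mul_ne_zero ?_ fun h => hk₀ (by rw [hXZ i k₀ hik₀, h, mul_zero])
    intro h
    refine hk₀ ?_
    have hne : i - k + k₀ ≠ k₀ := by simpa [sub_eq_zero] using hik
    rw [hXZ _ _ hne, add_sub_cancel_right, h, zero_mul]
  have hZ : ∀ i, Z i ≠ 0 := by
    intro i h
    obtain ⟨k, hk, -⟩ := hthird i i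
    exact hX k (by rw [hXZ i k hk.symm, h, mul_zero])
  have hpow : ∀ x : ZMod p, x ≠ 0 → x ^ (Fintype.card C - 1) = 1 := by
    intro x hx
    refine mul_right_cancel₀ hx ?_
    rw [← pow_succ, Nat.sub_add_cancel (by omega), hcard, ZMod.pow_card_pow, one_mul]
  -- Compare the equations at `(j, 0)` and `(k + j, k)`, which share the coefficient `ε j`.
  have hstep : ∀ k j, j ≠ 0 → Z (k + j) * X 0 = X k * Z j := by
    intro k j hj
    have h1 := hXZ j 0 hj
    have h2 := hXZ (k + j) k (by simpa using hj)
    rw [sub_zero] at h1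
    rw [add_sub_cancel_left] at h2
    rw [h1, h2]
    ring
  -- Multiplying over all `j ≠ 0`, the constants disappear because `x ^ (|C| - 1) = 1`.
  have hZconst : ∀ k, Z k = Z 0 := by
    intro k
    have h1 : ∏ j ∈ Finset.univ.erase (0 : C), (Z (k + j) * X 0) =
        ∏ j ∈ Finset.univ.erase (0 : C), (X k * Z j) :=
      Finset.prod_congr rfl fun j hj => hstep k j (Finset.ne_of_mem_erase hj)
    rw [Finset.prod_mul_distrib, Finset.prod_mul_distrib, Finset.prod_const, Finset.prod_const,
      Finset.card_erase_of_mem (Finset.mem_univ _), Finset.card_univ, hpow _ (hX 0),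
      hpow _ (hX k), mul_one, one_mul] at h1
    have h2 := Finset.mul_prod_erase Finset.univ (fun j => Z (k + j)) (Finset.mem_univ (0 : C))
    have h3 := Finset.mul_prod_erase Finset.univ Z (Finset.mem_univ (0 : C))
    have h4 : ∏ j, Z (k + j) = ∏ j, Z j := Equiv.prod_comp (Equiv.addLeft k) Z
    rw [h4, ← h3, h1, add_zero] at h2
    exact mul_right_cancel₀ (Finset.prod_ne_zero_iff.2 fun j _ => hZ j) h2
  have hε : ∀ j ∈ Finset.univ.erase (0 : C), ε j = X 0 / Z 0 := by
    intro j hj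
    rw [eq_div_iff (hZ 0), hXZ j 0 (Finset.ne_of_mem_erase hj), sub_zero, hZconst j]
  rw [Finset.sum_congr rfl hε, Finset.sum_const, Finset.card_erase_of_mem (Finset.mem_univ _),
    Finset.card_univ, nsmul_eq_mul]
  refine mul_ne_zero ?_ (div_ne_zero (hX 0) (hZ 0))
  intro h
  have hs : s ≠ 0 := by
    rintro rfl
    rw [pow_zero] at hcard
    omega
  have h1 : ((Fintype.card C - 1 + 1 : ℕ) : ZMod p) = 0 := by
    rw [Nat.sub_add_cancel (by omega), hcard, Nat.cast_pow, ZMod.natCast_self, zero_pow hs]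
  rw [Nat.cast_add, h, zero_add, Nat.cast_one] at h1
  exact one_ne_zero h1

/-- The rigidity lemma behind the torsion-type condition, with values in an abelian group: a
`p`-torsion solution of `x k = z i ^ e (i - k)` (`i ≠ k`) over a finite `p`-group `C` of order at
least `3` has `x = 1` as soon as the sum of the exponents vanishes modulo `p`. -/
theorem eq_one_of_exponent_system {p : ℕ} [Fact p.Prime] {C : Type*} [AddCommGroup C] [Fintype C]
    {s : ℕ} (hcard : Fintype.card C = p ^ s) (hC : 3 ≤ Fintype.card C) {V : Type*} [CommGroup V]
    (e : C → ℤ) (h0 : e 0 = 0) (hsum : (p : ℤ) ∣ ∑ c, e c) (x z : C → V) (hz : ∀ i, z i ^ p = 1)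
    (hxz : ∀ i k, i ≠ k → x k = z i ^ e (i - k)) (k : C) : x k = 1 := by
  classical
  by_contra hk
  have hx : ∀ k, x k ^ p = 1 := by
    intro k
    obtain ⟨i, hi⟩ := Fintype.exists_ne_of_one_lt_card (by omega) k
    rw [hxz i k hi, ← zpow_natCast, zpow_comm, zpow_natCast, hz, one_zpow]
  -- The `p`-torsion of `V` is a vector space over `ZMod p`; a functional that does not kill the
  -- non-trivial value reduces the claim to the scalar system.
  let T := AddSubgroup.torsionBy (Additive V) (p : ℤ)
  have hmem : ∀ v : V, v ^ p = 1 → Additive.ofMul v ∈ T := by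
    intro v hv
    show (p : ℤ) • Additive.ofMul v = 0
    rw [← ofMul_zpow, zpow_natCast, hv, ofMul_one]
  let x' : C → T := fun k => ⟨Additive.ofMul (x k), hmem _ (hx k)⟩
  let z' : C → T := fun k => ⟨Additive.ofMul (z k), hmem _ (hz k)⟩
  have hxz' : ∀ i k, i ≠ k → x' k = e (i - k) • z' i := by
    intro i k hik
    refine Subtype.ext ?_
    show Additive.ofMul (x k) = e (i - k) • Additive.ofMul (z i)
    rw [hxz i k hik, ofMul_zpow]
  have hk' : x' k ≠ 0 := fun h => hk (congrArg Subtype.val h)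
  let _ : Module (ZMod p) T := AddSubgroup.torsionBy.zmodModule
  obtain ⟨f, hf⟩ := Module.Projective.exists_dual_ne_zero (ZMod p) hk'
  refine sum_ne_zero_of_scalar_system hcard hC (fun j => (e j : ZMod p)) (fun k => f (x' k))
    (fun i => f (z' i)) ?_ hf ?_
  · intro i k hik
    show f (x' k) = _
    rw [hxz' i k hik, map_zsmul, zsmul_eq_mul]
  · rw [Finset.sum_erase _ (by rw [h0, Int.cast_zero]), ← Int.cast_sum]
    exact (ZMod.intCast_zmod_eq_zero_iff_dvd _ _).2 hsum

/-- An element of `p`-power order is trivial if a power of it with exponent prime to `p` is. -/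
theorem eq_one_of_zpow_eq_one {V : Type*} [Group V] {p m : ℕ} (hp : p.Prime) {v : V}
    (hv : v ^ p ^ m = 1) {t : ℤ} (ht : ¬ (p : ℤ) ∣ t) (h : v ^ t = 1) : v = 1 := by
  have hco : IsCoprime t ((p : ℤ) ^ m) :=
    (((Nat.prime_iff_prime_int.1 hp).coprime_iff_not_dvd.2 ht).symm).pow_right
  obtain ⟨a, b, hab⟩ := hco
  have : v ^ (a * t + b * (p : ℤ) ^ m) = 1 := by
    rw [zpow_add, mul_comm a, mul_comm b, zpow_mul, zpow_mul, h, ← Nat.cast_pow, zpow_natCast, hv,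
      one_zpow, one_zpow, one_mul]
  rwa [hab, zpow_one] at this

/-- An element of `p`-power order is a power of each of its powers with exponent prime to `p`. -/
theorem exists_zpow_zpow_eq {V : Type*} [Group V] {p m : ℕ} (hp : p.Prime) {v : V}
    (hv : v ^ p ^ m = 1) {t : ℤ} (ht : ¬ (p : ℤ) ∣ t) : ∃ r : ℤ, (v ^ t) ^ r = v := by
  have hco : IsCoprime t ((p : ℤ) ^ m) :=
    (((Nat.prime_iff_prime_int.1 hp).coprime_iff_not_dvd.2 ht).symm).pow_right
  obtain ⟨a, b, hab⟩ := hco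
  refine ⟨a, ?_⟩
  calc (v ^ t) ^ a = v ^ (a * t + b * (p : ℤ) ^ m) := by
        rw [zpow_add, mul_comm a, mul_comm b, zpow_mul, zpow_mul, ← Nat.cast_pow, zpow_natCast, hv,
          one_zpow, mul_one]
    _ = v := by rw [hab, zpow_one]

/-- `eq_one_of_exponent_system` for elements of arbitrary `p`-power order. -/
theorem eq_one_of_exponent_system_of_pow {p : ℕ} [Fact p.Prime] {C : Type*} [AddCommGroup C]
    [Fintype C] {s : ℕ} (hcard : Fintype.card C = p ^ s) (hC : 3 ≤ Fintype.card C) {V : Type*}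
    [CommGroup V] (e : C → ℤ) (h0 : e 0 = 0) (hsum : (p : ℤ) ∣ ∑ c, e c) {j : C}
    (hj : ¬ (p : ℤ) ∣ e j) (x z : C → V) {m : ℕ} (hz : ∀ i, z i ^ p ^ m = 1)
    (hxz : ∀ i k, i ≠ k → x k = z i ^ e (i - k)) (k : C) : x k = 1 ∧ z k = 1 := by
  have hj0 : j ≠ 0 := by
    rintro rfl
    exact hj (h0 ▸ dvd_zero _)
  -- As `e j` is prime to `p`, each `z i` is a power of some `x k`.
  have hzx : ∀ r, (∀ k, x k ^ p ^ r = 1) → ∀ i, z i ^ p ^ r = 1 := by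
    intro r hr i
    refine eq_one_of_zpow_eq_one (m := m) Fact.out ?_ hj ?_
    · rw [← pow_mul, mul_comm, pow_mul, hz, one_pow]
    · have h := hxz i (i - j) (fun h => hj0 (sub_eq_self.1 h.symm))
      rw [sub_sub_cancel] at h
      rw [← zpow_natCast, zpow_comm, ← h, zpow_natCast, hr]
  have hdesc : ∀ r, (∀ k, x k ^ p ^ r = 1) → ∀ k, x k = 1 := by
    intro r
    induction r with
    | zero => intro h k; simpa using h k
    | succ r ih =>
      intro h
      refine ih (eq_one_of_exponent_system hcard hC e h0 hsum (fun k => x k ^ p ^ r)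
        (fun k => z k ^ p ^ r) ?_ ?_)
      · intro i
        show (z i ^ p ^ r) ^ p = 1
        rw [← pow_mul, ← pow_succ]
        exact hzx _ h i
      · intro i k hik
        show x k ^ p ^ r = (z i ^ p ^ r) ^ e (i - k)
        rw [hxz i k hik, ← zpow_natCast, zpow_comm, zpow_natCast]
  have hx : ∀ k, x k = 1 := by
    refine hdesc m fun k => ?_
    obtain ⟨i, hi⟩ := Fintype.exists_ne_of_one_lt_card (by omega) k
    rw [hxz i k hi, ← zpow_natCast, zpow_comm, zpow_natCast, hz, one_zpow]
  exact ⟨hx k, by simpa using hzx 0 (fun k => by simpa using hx k) k⟩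

/-! ### Directed tuples -/

/-- If `α` and `β` generate `A`, a normal subgroup containing `⁅α, β⁆` contains `⁅A, A⁆`. -/
theorem commutator_le_of_generators {A : Type*} [Group A] {α β : A}
    (hgen : Subgroup.closure {α, β} = ⊤) (N : Subgroup A) [N.Normal] (h : ⁅α, β⁆ ∈ N) :
    commutator A ≤ N := by
  -- The elements whose commutator with `y` lies in `N` form a subgroup.
  have key : ∀ {S : Set A} {y : A}, (∀ x : A, x ∈ S → ⁅x, y⁆ ∈ N) →
      Subgroup.closure S = ⊤ → ∀ x : A, ⁅x, y⁆ ∈ N := by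
    intro S y hS htop x
    have hx : x ∈ Subgroup.closure S := htop ▸ Subgroup.mem_top x
    induction hx using Subgroup.closure_induction with
    | mem x hx => exact hS x hx
    | one => rw [commutatorElement_one_left]; exact N.one_mem
    | mul x z _ _ hx hz =>
      have : ⁅x * z, y⁆ = x * ⁅z, y⁆ * x⁻¹ * ⁅x, y⁆ := by simp only [commutatorElement_def]; group
      rw [this]
      exact N.mul_mem (Subgroup.Normal.conj_mem ‹_› _ hz x) hx
    | inv x _ hx =>
      have : ⁅x⁻¹, y⁆ = x⁻¹ * ⁅x, y⁆⁻¹ * x⁻¹⁻¹ := by simp only [commutatorElement_def]; group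
      rw [this]
      exact Subgroup.Normal.conj_mem ‹_› _ (N.inv_mem hx) x⁻¹
  have hsymm : ∀ {x y : A}, ⁅x, y⁆ ∈ N → ⁅y, x⁆ ∈ N := by
    intro x y hxy
    rw [← commutatorElement_inv]
    exact N.inv_mem hxy
  have h1 : ∀ y : A, y ∈ ({α, β} : Set A) → ∀ x : A, ⁅x, y⁆ ∈ N := by
    rintro y (rfl | rfl)
    · refine key ?_ hgen
      rintro x (rfl | rfl)
      · rw [commutatorElement_self]; exact N.one_mem
      · exact hsymm h
    · refine key ?_ hgen
      rintro x (rfl | rfl)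
      · exact h
      · rw [commutatorElement_self]; exact N.one_mem
  rw [commutator_def, Subgroup.commutator_le]
  intro x _ y _
  exact key (fun z hz => hsymm (h1 z hz y)) hgen x

instance gamma3_top_normal {A : Type*} [Group A] : (gamma3 (⊤ : Subgroup A)).Normal :=
  Subgroup.commutator_normal _ _

theorem gamma3_le_commutator_top {A : Type*} [Group A] :
    gamma3 (⊤ : Subgroup A) ≤ commutator A :=
  Subgroup.commutator_le_left _ _

theorem commutator_mem_gamma3_top {A : Type*} [Group A] {y : A} (hy : y ∈ commutator A)
    (h : A) : ⁅y, h⁆ ∈ gamma3 (⊤ : Subgroup A) :=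
  Subgroup.commutator_mem_commutator hy (Subgroup.mem_top h)

theorem commutator_mem_commutator_top {A : Type*} [Group A] (x y : A) :
    ⁅x, y⁆ ∈ commutator A :=
  Subgroup.commutator_mem_commutator (Subgroup.mem_top x) (Subgroup.mem_top y)

section Tuples

variable {A : Type*} [Group A] {ι : Type*} [DecidableEq ι]

/-- The tuple with entries `x` at `i` and `y` at `j` and trivial entries elsewhere. -/
def pairTuple (i j : ι) (x y : A) : ι → A :=
  fun k => if k = i then x else if k = j then y else 1

theorem pairTuple_mul (i j : ι) (x y x' y' : A) :
    pairTuple i j x y * pairTuple i j x' y' = pairTuple i j (x * x') (y * y') := by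
  funext k
  simp only [pairTuple, Pi.mul_apply]
  split_ifs <;> simp

theorem pairTuple_one (i j : ι) : pairTuple i j (1 : A) 1 = 1 := by
  funext k
  simp [pairTuple]

theorem pairTuple_inv (i j : ι) (x y : A) : (pairTuple i j x y)⁻¹ = pairTuple i j x⁻¹ y⁻¹ := by
  funext k
  simp only [pairTuple, Pi.inv_apply]
  split_ifs <;> simp

theorem pairTuple_commutator (i j : ι) (x y : A) (g : ι → A) :
    ⁅pairTuple i j x y, g⁆ = pairTuple i j ⁅x, g i⁆ ⁅y, g j⁆ := by
  funext k
  simp only [pairTuple, commutatorElement_def, Pi.mul_apply, Pi.inv_apply]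
  split_ifs with h h' <;> simp_all

theorem pairTuple_conj (i j : ι) (x y : A) (g : ι → A) :
    g * pairTuple i j x y * g⁻¹ = pairTuple i j (g i * x * (g i)⁻¹) (g j * y * (g j)⁻¹) := by
  funext k
  simp only [pairTuple, Pi.mul_apply, Pi.inv_apply]
  split_ifs with h h' <;> simp_all

theorem pairTuple_one_right (i j : ι) (x : A) : pairTuple i j x 1 = Pi.mulSingle i x := by
  funext k
  simp only [pairTuple, Pi.mulSingle_apply]
  split_ifs <;> rfl

theorem pairTuple_one_left {i j : ι} (h : i ≠ j) (y : A) :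
    pairTuple i j 1 y = Pi.mulSingle j y := by
  funext k
  simp only [pairTuple, Pi.mulSingle_apply]
  split_ifs <;> simp_all

theorem pairTuple_eq_mul {i j : ι} (h : i ≠ j) (x y : A) :
    pairTuple i j x y = Pi.mulSingle i x * Pi.mulSingle j y := by
  rw [← pairTuple_one_right i j, ← pairTuple_one_left h, pairTuple_mul, mul_one, one_mul]

theorem mulSingle_conj (i : ι) (x : A) (g : ι → A) :
    g * Pi.mulSingle i x * g⁻¹ = Pi.mulSingle i (g i * x * (g i)⁻¹) := by
  rw [← pairTuple_one_right i i, pairTuple_conj, mul_one, mul_inv_cancel, pairTuple_one_right]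

variable [AddCommGroup ι]

/-- The directed tuple with entry `β` at `i` and entry `α ^ e j` at `i + j` for `j ≠ 0`. -/
def dirTuple (α β : A) (e : ι → ℤ) (i : ι) : ι → A :=
  fun k => if k = i then β else α ^ e (k - i)

/-- The subgroup generated by the directed tuples. -/
def dirGroup (α β : A) (e : ι → ℤ) : Subgroup (ι → A) :=
  Subgroup.closure (Set.range (dirTuple α β e))

variable {α β : A} {e : ι → ℤ}

theorem dirTuple_self (i : ι) : dirTuple α β e i i = β := if_pos rfl

theorem dirTuple_of_ne {i k : ι} (h : k ≠ i) : dirTuple α β e i k = α ^ e (k - i) := if_neg h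

theorem dirTuple_mem (i : ι) : dirTuple α β e i ∈ dirGroup α β e :=
  Subgroup.subset_closure ⟨i, rfl⟩

/-- The entries of two directed tuples commute except at the two positions of `β`. -/
theorem dirTuple_commutator {j : ι} (hj : j ≠ 0) (i : ι) :
    ⁅dirTuple α β e i, dirTuple α β e (i + j)⁆ =
      pairTuple i (i + j) ⁅β, α ^ e (-j)⁆ ⁅α ^ e j, β⁆ := by
  funext k
  show ⁅dirTuple α β e i k, dirTuple α β e (i + j) k⁆ = _
  have hij : i ≠ i + j := by simpa using hj
  by_cases h1 : k = i
  · subst h1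
    rw [dirTuple_self, dirTuple_of_ne hij, pairTuple, if_pos rfl, sub_add_cancel_left]
  · by_cases h2 : k = i + j
    · subst h2
      rw [dirTuple_self, dirTuple_of_ne h1, pairTuple, if_neg h1, if_pos rfl, add_sub_cancel_left]
    · rw [dirTuple_of_ne h1, dirTuple_of_ne h2, pairTuple, if_neg h1, if_neg h2,
        commutatorElement_eq_one_iff_commute]
      exact Commute.zpow_zpow (Commute.refl α) _ _

/-- The entries at a given position of the tuples in the directed group exhaust `⟨α, β⟩`. -/
theorem exists_mem_dirGroup_apply_eq_of_mem_closure {p m : ℕ} (hp : p.Prime) (hα : α ^ p ^ m = 1)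
    (he0 : e 0 = 0) {s : ι} (hs : ¬ (p : ℤ) ∣ e s) (i : ι) {h : A}
    (hh : h ∈ Subgroup.closure {α, β}) : ∃ g ∈ dirGroup α β e, g i = h := by
  suffices hle : Subgroup.closure {α, β} ≤
      (dirGroup α β e).map (Pi.evalMonoidHom (fun _ => A) i) from hle hh
  rw [Subgroup.closure_le]
  have hs0 : s ≠ 0 := by
    rintro rfl
    exact hs (he0 ▸ dvd_zero _)
  rintro x (rfl | rfl)
  · obtain ⟨r, hr⟩ := exists_zpow_zpow_eq hp hα hs
    refine ⟨dirTuple x β e (i - s) ^ r, Subgroup.zpow_mem _ (dirTuple_mem _) r, ?_⟩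
    show (dirTuple x β e (i - s) i) ^ r = x
    rw [dirTuple_of_ne (fun h => hs0 (sub_eq_self.1 h.symm)), sub_sub_cancel, hr]
  · exact ⟨dirTuple α x e i, dirTuple_mem i, dirTuple_self i⟩

theorem exists_mem_dirGroup_apply_eq {p m : ℕ} (hp : p.Prime)
    (hgen : Subgroup.closure {α, β} = ⊤) (hα : α ^ p ^ m = 1) (he0 : e 0 = 0) {s : ι}
    (hs : ¬ (p : ℤ) ∣ e s) (i : ι) (h : A) : ∃ g ∈ dirGroup α β e, g i = h :=
  exists_mem_dirGroup_apply_eq_of_mem_closure hp hα he0 hs i (hgen ▸ Subgroup.mem_top h)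

end Tuples

/-- Homomorphisms `φ i`, one for each coordinate `i`, from the derived subgroup of `A` to an abelian
group `V` (given as functions on `A`), on which a group `M` of tuples acts compatibly: equality of
values is preserved under conjugation by the coordinates of an element of `M`. -/
structure CoordinateMaps {A ι : Type*} [Group A] (M : Subgroup (ι → A)) (V : Type*)
    [CommGroup V] where
  /-- The map at each coordinate. -/
  φ : ι → A → V
  map_mul : ∀ i, ∀ x ∈ commutator A, ∀ y ∈ commutator A,
    φ i (x * y) = φ i x * φ i y
  map_conj : ∀ g ∈ M, ∀ i i', ∀ w ∈ commutator A, ∀ w' ∈ commutator A,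
    φ i w = φ i' w' → φ i (g i * w * (g i)⁻¹) = φ i' (g i' * w' * (g i')⁻¹)

namespace CoordinateMaps

variable {A ι : Type*} [Group A] {M : Subgroup (ι → A)} {V : Type*} [CommGroup V]
  (Φ : CoordinateMaps M V)

theorem map_one (i : ι) : Φ.φ i 1 = 1 := by
  have h := Φ.map_mul i 1 (one_mem _) 1 (one_mem _)
  rw [mul_one] at h
  exact (left_eq_mul.1 h)

theorem map_inv (i : ι) {x : A} (hx : x ∈ commutator A) : Φ.φ i x⁻¹ = (Φ.φ i x)⁻¹ := by
  rw [eq_inv_iff_mul_eq_one, ← Φ.map_mul i _ (inv_mem hx) _ hx, inv_mul_cancel, Φ.map_one]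

/-- The elements of `A` which act trivially on the image of `γ₃(A)` under the `i`-th map. -/
def fixer (i : ι) : Subgroup A where
  carrier := {h | ∀ w ∈ gamma3 (⊤ : Subgroup A), Φ.φ i (h * w * h⁻¹) = Φ.φ i w}
  one_mem' := fun w _ => by rw [one_mul, inv_one, mul_one]
  mul_mem' := by
    intro g h hg hh w hw
    have h1 := hg _ (Subgroup.Normal.conj_mem inferInstance w hw h)
    rw [hh w hw] at h1
    rw [← h1]
    congr 1
    group
  inv_mem' := by
    intro h hh w hw
    have h1 := hh _ (Subgroup.Normal.conj_mem inferInstance w hw h⁻¹)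
    rw [← h1]
    congr 1
    group

/-- The derived subgroup acts trivially because the target is abelian. -/
theorem commutator_le_fixer (i : ι) : commutator A ≤ Φ.fixer i := by
  intro x hx w hw
  have hw' := gamma3_le_commutator_top hw
  rw [Φ.map_mul i _ (mul_mem hx hw') _ (inv_mem hx), Φ.map_mul i _ hx _ hw', Φ.map_inv i hx,
    mul_comm (Φ.φ i x), mul_inv_cancel_right]

end CoordinateMaps

/-! ### Coordinate maps on the third term of the lower central series -/

/-- The subgroup of the index group generated by the positions at which the exponent is prime
to `p`. -/
def unitSupport {ι : Type*} [AddCommGroup ι] (p : ℕ) (e : ι → ℤ) : AddSubgroup ι :=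
  AddSubgroup.closure {j | ¬ (p : ℤ) ∣ e j}

/-- Outside `unitSupport` the exponents are divisible by `p`, so its sum is still divisible. -/
theorem dvd_sum_unitSupport {ι : Type*} [AddCommGroup ι] [Fintype ι] {p : ℕ} {e : ι → ℤ}
    [Fintype (unitSupport p e)] (hsum : (p : ℤ) ∣ ∑ i, e i) :
    (p : ℤ) ∣ ∑ c : unitSupport p e, e c := by
  classical
  have h1 := Finset.sum_filter_add_sum_filter_not Finset.univ (fun i => i ∈ unitSupport p e) e
  have h2 : ∑ i with i ∈ unitSupport p e, e i = ∑ c : unitSupport p e, e c :=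
    Finset.sum_subtype _ (by simp) e
  have h3 : (p : ℤ) ∣ ∑ i with i ∉ unitSupport p e, e i := by
    refine Finset.dvd_sum fun i hi => ?_
    by_contra h
    exact (Finset.mem_filter.1 hi).2 (AddSubgroup.subset_closure h)
  rw [← h1, h2] at hsum
  exact (dvd_add_left h3).1 hsum

theorem card_unitSupport {ι : Type*} [AddCommGroup ι] [Fintype ι] {p n : ℕ} [Fact p.Prime]
    (hp2 : p ≠ 2) (hι : Fintype.card ι = p ^ n) {e : ι → ℤ} (he0 : e 0 = 0) {j : ι}
    (hj : ¬ (p : ℤ) ∣ e j) [Fintype (unitSupport p e)] :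
    ∃ s, Fintype.card (unitSupport p e) = p ^ s ∧ 3 ≤ Fintype.card (unitSupport p e) := by
  have hdvd := (unitSupport p e).card_addSubgroup_dvd_card
  rw [Nat.card_eq_fintype_card, Nat.card_eq_fintype_card, hι] at hdvd
  obtain ⟨s, -, hs⟩ := (Nat.dvd_prime_pow Fact.out).1 hdvd
  refine ⟨s, hs, ?_⟩
  have hs0 : s ≠ 0 := by
    rintro rfl
    rw [pow_zero] at hs
    have hj0 : j ≠ 0 := by
      rintro rfl
      exact hj (he0 ▸ dvd_zero _)
    have := Fintype.card_le_one_iff.1 hs.le ⟨j, AddSubgroup.subset_closure hj⟩ 0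
    exact hj0 (congrArg Subtype.val this)
  have hp3 : 3 ≤ p := by
    have := (Fact.out : p.Prime).two_le
    omega
  rw [hs]
  exact hp3.trans (Nat.le_self_pow hs0 p)

namespace CoordinateMaps

variable {A : Type*} [Group A] {ι : Type*} [AddCommGroup ι] [DecidableEq ι] [Fintype ι]
  {α β : A} {e : ι → ℤ} {V : Type*} [CommGroup V]

/-- If the images of `γ₃(A)` under the coordinate maps agree along the cosets of `unitSupport`, then
`A` acts trivially on each of them: the action of a directed tuple can be read off at any coordinate
of the coset, which gives a system as in `eq_one_of_exponent_system_of_pow`. -/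
theorem fixer_eq_top {p m n : ℕ} [Fact p.Prime] (hp2 : p ≠ 2) (hι : Fintype.card ι = p ^ n)
    (hgen : Subgroup.closure {α, β} = ⊤) (hα : α ^ p ^ m = 1) (he0 : e 0 = 0)
    (hsum : (p : ℤ) ∣ ∑ i, e i) {s : ι} (hs : ¬ (p : ℤ) ∣ e s)
    (Φ : CoordinateMaps (dirGroup α β e) V)
    (himage : ∀ c ∈ unitSupport p e, ∀ i, ∀ w ∈ gamma3 (⊤ : Subgroup A),
      ∃ w' ∈ gamma3 (⊤ : Subgroup A), Φ.φ i w = Φ.φ (i + c) w') (i : ι) :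
    Φ.fixer i = ⊤ := by
  classical
  have hle := Φ.commutator_le_fixer i
  have hnormal : (Φ.fixer i).Normal := Subgroup.Normal.of_commutator_le A hle
  have hcomm : IsMulCommutative (A ⧸ Φ.fixer i) :=
    Subgroup.Normal.quotient_commutative_iff_commutator_le.2 hle
  let _ : CommGroup (A ⧸ Φ.fixer i) :=
    { (inferInstance : Group (A ⧸ Φ.fixer i)) with mul_comm := hcomm.is_comm.comm }
  -- The action at `i` of a tuple of the group only depends on its entry at `i + c`.
  have htransfer : ∀ c ∈ unitSupport p e, ∀ g ∈ dirGroup α β e, g (i + c) = 1 →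
      g i ∈ Φ.fixer i := by
    intro c hc g hg h1 w hw
    obtain ⟨w', hw', hww'⟩ := himage c hc i w hw
    have h := Φ.map_conj g hg i (i + c) w (gamma3_le_commutator_top hw) w'
      (gamma3_le_commutator_top hw') hww'
    rw [h, h1, one_mul, inv_one, mul_one, hww']
  have htransfer' : ∀ c ∈ unitSupport p e, ∀ g ∈ dirGroup α β e, ∀ g' ∈ dirGroup α β e,
      g (i + c) = g' (i + c) → (g i : A ⧸ Φ.fixer i) = g' i := by
    intro c hc g hg g' hg' h
    rw [QuotientGroup.eq]
    exact htransfer c hc (g⁻¹ * g') (mul_mem (inv_mem hg) hg')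
      (by rw [Pi.mul_apply, Pi.inv_apply, h, inv_mul_cancel])
  -- The system: `x k` is the action at `i` of the directed tuple at `i + k`, and `z c` the action at
  -- `i` of a tuple with entry `α` at `i + c`.
  choose f hfmem hf using fun c : unitSupport p e =>
    exists_mem_dirGroup_apply_eq (β := β) Fact.out hgen hα he0 hs (i + c) α
  obtain ⟨r, hr, hr3⟩ := card_unitSupport hp2 hι he0 hs
  have hsol := eq_one_of_exponent_system_of_pow (V := A ⧸ Φ.fixer i) hr hr3
    (fun c : unitSupport p e => e c) he0
    (dvd_sum_unitSupport hsum) (j := ⟨s, AddSubgroup.subset_closure hs⟩) hs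
    (fun k => ((dirTuple α β e (i + k) i : A) : A ⧸ Φ.fixer i)) (fun c => ((f c i : A) : A ⧸ _))
    (m := m) ?_ ?_ 0
  · rw [eq_top_iff, ← hgen, Subgroup.closure_le]
    have h0 : ((0 : unitSupport p e) : ι) = 0 := rfl
    have hf0 : f 0 i = α := by
      have := hf 0
      rwa [h0, add_zero] at this
    have hb0 : dirTuple α β e (i + (0 : unitSupport p e)) i = β := by
      rw [h0, add_zero, dirTuple_self]
    rintro x (rfl | rfl)
    · have := hsol.2
      rwa [hf0, QuotientGroup.eq_one_iff] at this
    · have := hsol.1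
      rwa [hb0, QuotientGroup.eq_one_iff] at this
  · intro c
    show ((f c i : A) : A ⧸ Φ.fixer i) ^ p ^ m = 1
    rw [← QuotientGroup.mk_pow, QuotientGroup.eq_one_iff]
    refine htransfer c c.2 (f c ^ p ^ m) (pow_mem (hfmem c) _) ?_
    rw [Pi.pow_apply, hf, hα]
  · intro c k hck
    show ((dirTuple α β e (i + k) i : A) : A ⧸ Φ.fixer i) = ((f c i : A) : A ⧸ _) ^ e (c - k)
    rw [← QuotientGroup.mk_zpow]
    refine htransfer' c c.2 _ (dirTuple_mem _) (f c ^ e (c - k)) (zpow_mem (hfmem c) _) ?_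
    rw [Pi.pow_apply, hf, dirTuple_of_ne, add_sub_add_left_eq_sub]
    intro h
    exact hck (Subtype.ext (add_left_cancel h))

end CoordinateMaps

namespace CoordinateMaps

section Bracket

variable {A ι : Type*} [Group A] {M : Subgroup (ι → A)} {V : Type*} [CommGroup V]
  (Φ : CoordinateMaps M V) {i : ι}

theorem map_conj_of_fixer (hfix : Φ.fixer i = ⊤) (h : A) {w : A}
    (hw : w ∈ gamma3 (⊤ : Subgroup A)) : Φ.φ i (h * w * h⁻¹) = Φ.φ i w :=
  (hfix ▸ Subgroup.mem_top h : h ∈ Φ.fixer i) w hw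

theorem bracket_mul_left (hfix : Φ.fixer i = ⊤) {y y' : A} (hy' : y' ∈ commutator A)
    (h : A) :
    Φ.φ i ⁅y * y', h⁆ = Φ.φ i ⁅y, h⁆ * Φ.φ i ⁅y', h⁆ := by
  have h' := commutator_mem_gamma3_top hy' h
  rw [commutatorElement_mul_left_eq_conj_mul, Φ.map_mul i _
    (gamma3_le_commutator_top (Subgroup.Normal.conj_mem inferInstance _ h' y)) _
    (commutator_mem_commutator_top _ _), Φ.map_conj_of_fixer hfix y h', mul_comm]

theorem bracket_mul_right (hfix : Φ.fixer i = ⊤) {y : A} (hy : y ∈ commutator A) (h h' : A) :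
    Φ.φ i ⁅y, h * h'⁆ = Φ.φ i ⁅y, h⁆ * Φ.φ i ⁅y, h'⁆ := by
  have hm := commutator_mem_gamma3_top hy h'
  have : ⁅y, h * h'⁆ = ⁅y, h⁆ * (h * ⁅y, h'⁆ * h⁻¹) := by
    simp only [commutatorElement_def]; group
  rw [this, Φ.map_mul i _ (commutator_mem_commutator_top _ _) _
    (gamma3_le_commutator_top (Subgroup.Normal.conj_mem inferInstance _ hm h)),
    Φ.map_conj_of_fixer hfix h hm]

theorem bracket_of_mem_gamma3 (hfix : Φ.fixer i = ⊤) {y : A} (hy : y ∈ gamma3 (⊤ : Subgroup A))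
    (h : A) : Φ.φ i ⁅y, h⁆ = 1 := by
  have hy' := inv_mem hy
  have : ⁅y, h⁆ = y * (h * y⁻¹ * h⁻¹) := by simp only [commutatorElement_def]; group
  rw [this, Φ.map_mul i _ (gamma3_le_commutator_top hy) _
    (gamma3_le_commutator_top (Subgroup.Normal.conj_mem inferInstance _ hy' h)),
    Φ.map_conj_of_fixer hfix h hy', Φ.map_inv i (gamma3_le_commutator_top hy), mul_inv_cancel]

theorem bracket_conj (hfix : Φ.fixer i = ⊤) {y : A} (hy : y ∈ commutator A) (a h : A) :
    Φ.φ i ⁅a * y * a⁻¹, h⁆ = Φ.φ i ⁅y, h⁆ := by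
  have hm : ⁅a, y⁆ ∈ gamma3 (⊤ : Subgroup A) := by
    rw [← commutatorElement_inv]
    exact inv_mem (commutator_mem_gamma3_top hy a)
  have : a * y * a⁻¹ = ⁅a, y⁆ * y := by simp only [commutatorElement_def]; group
  rw [this, Φ.bracket_mul_left hfix hy,
    Φ.bracket_of_mem_gamma3 hfix hm, one_mul]

/-- `⁅⁅α ^ t, β⁆, h⁆` and `⁅⁅α, β⁆, h⁆ ^ t` have the same value: the inner commutator is
multiplicative in `α` up to conjugation. -/
theorem bracket_zpow (hfix : Φ.fixer i = ⊤) (α β h : A) (t : ℤ) :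
    Φ.φ i ⁅⁅α ^ t, β⁆, h⁆ = Φ.φ i ⁅⁅α, β⁆, h⁆ ^ t := by
  let f : Multiplicative ℤ →* V := MonoidHom.mk' (fun t => Φ.φ i ⁅⁅α ^ t.toAdd, β⁆, h⁆) (by
    intro s t
    rw [toAdd_mul, zpow_add, commutatorElement_mul_left_eq_conj_mul,
      Φ.bracket_mul_left hfix (commutator_mem_commutator_top _ _),
      Φ.bracket_conj hfix (commutator_mem_commutator_top _ _), mul_comm])
  have h1 := map_zpow f (Multiplicative.ofAdd 1) t
  rw [← ofAdd_zsmul, smul_eq_mul, mul_one] at h1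
  simpa [f] using h1

theorem bracket_inv_left (hfix : Φ.fixer i = ⊤) {y : A} (hy : y ∈ commutator A) (h : A) :
    Φ.φ i ⁅y⁻¹, h⁆ = (Φ.φ i ⁅y, h⁆)⁻¹ := by
  rw [eq_inv_iff_mul_eq_one, ← Φ.bracket_mul_left hfix hy, inv_mul_cancel,
    commutatorElement_one_left, Φ.map_one]

/-- The homomorphism `h ↦ φ i ⁅⁅α, β⁆, h⁆`. -/
def bracketHom (hfix : Φ.fixer i = ⊤) (α β : A) : A →* V :=
  MonoidHom.mk' (fun h => Φ.φ i ⁅⁅α, β⁆, h⁆)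
    fun h h' => Φ.bracket_mul_right hfix (commutator_mem_commutator_top α β) h h'

theorem bracketHom_apply (hfix : Φ.fixer i = ⊤) (α β h : A) :
    Φ.bracketHom hfix α β h = Φ.φ i ⁅⁅α, β⁆, h⁆ := rfl

/-- Once `A` acts trivially, the values on `γ₃(A)` are controlled by `bracketHom`. -/
theorem map_gamma3_eq_one_of_bracketHom (hfix : Φ.fixer i = ⊤) {α β : A}
    (hgen : Subgroup.closure {α, β} = ⊤) (h1 : ∀ h, Φ.bracketHom hfix α β h = 1) {w : A}
    (hw : w ∈ gamma3 (⊤ : Subgroup A)) : Φ.φ i w = 1 := by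
  let N : Subgroup A :=
    { carrier := {y | y ∈ commutator A ∧ ∀ h, Φ.φ i ⁅y, h⁆ = 1}
      one_mem' := ⟨one_mem _, fun h => by rw [commutatorElement_one_left, Φ.map_one]⟩
      mul_mem' := fun {x y} hx hy => ⟨mul_mem hx.1 hy.1, fun h => by
        rw [Φ.bracket_mul_left hfix hy.1, hx.2, hy.2, one_mul]⟩
      inv_mem' := fun {x} hx => ⟨inv_mem hx.1, fun h => by
        rw [Φ.bracket_inv_left hfix hx.1, hx.2, inv_one]⟩ }
  have hN : N.Normal := ⟨fun x hx g => ⟨Subgroup.Normal.conj_mem inferInstance _ hx.1 g, fun h => by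
    rw [Φ.bracket_conj hfix hx.1, hx.2]⟩⟩
  have hle : commutator A ≤ N :=
    commutator_le_of_generators hgen N ⟨commutator_mem_commutator_top _ _, h1⟩
  let K : Subgroup A :=
    { carrier := {y | y ∈ commutator A ∧ Φ.φ i y = 1}
      one_mem' := ⟨one_mem _, Φ.map_one i⟩
      mul_mem' := fun {x y} hx hy => ⟨mul_mem hx.1 hy.1, by
        rw [Φ.map_mul i x hx.1 y hy.1, hx.2, hy.2, one_mul]⟩
      inv_mem' := fun {x} hx => ⟨inv_mem hx.1, by rw [Φ.map_inv i hx.1, hx.2, inv_one]⟩ }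
  have hK : gamma3 (⊤ : Subgroup A) ≤ K :=
    (Subgroup.commutator_le).2 fun y hy h _ => ⟨commutator_mem_commutator_top _ _, (hle hy).2 h⟩
  exact (hK hw).2

end Bracket

variable {A : Type*} [Group A] {ι : Type*} [AddCommGroup ι] [DecidableEq ι] [Fintype ι]
  {α β : A} {e : ι → ℤ} {V : Type*} [CommGroup V]

/-- A family of homomorphisms `v i` from `A` to the `p`-torsion of an abelian group is trivial if
`v (i + j) ^ e j` and `v i ^ e (-j)` agree along the elements of the directed group. Going round the
cyclic group generated by `j` shows that the `v i` agree along the cosets of `unitSupport`, and then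
`eq_one_of_exponent_system` applies. -/
theorem bracketHom_pow_eq_one {p m n : ℕ} [Fact p.Prime] (hp2 : p ≠ 2)
    (hι : Fintype.card ι = p ^ n) (hgen : Subgroup.closure {α, β} = ⊤) (hα : α ^ p ^ m = 1)
    (he0 : e 0 = 0) (hsum : (p : ℤ) ∣ ∑ i, e i) {s : ι} (hs : ¬ (p : ℤ) ∣ e s)
    (v : ι → A →* V) (hv : ∀ i h, v i h ^ p = 1)
    (hrel : ∀ i j, ∀ g ∈ dirGroup α β e, v (i + j) (g (i + j)) ^ e j = v i (g i) ^ e (-j))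
    (i : ι) (h : A) : v i h = 1 := by
  classical
  have hpow1 : ∀ i h, v i h ^ p ^ 1 = 1 := fun i h => by rw [pow_one, hv]
  have hiter : ∀ j i, ∀ g ∈ dirGroup α β e, ∀ k : ℕ,
      v (i + k • j) (g (i + k • j)) ^ e j ^ k = v i (g i) ^ e (-j) ^ k := by
    intro j i g hg k
    induction k with
    | zero => rw [zero_smul, add_zero, pow_zero, pow_zero]
    | succ k ih =>
      rw [succ_nsmul, ← add_assoc, pow_succ', zpow_mul, hrel _ _ g hg, zpow_comm, ih, ← zpow_mul,
        pow_succ]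
  have hcycle : ∀ j i, ∀ g ∈ dirGroup α β e, v i (g i) ^ (e j ^ p ^ n - e (-j) ^ p ^ n) = 1 := by
    intro j i g hg
    have h1 := hiter j i g hg (p ^ n)
    rw [← hι, card_nsmul_eq_zero, add_zero, hι] at h1
    rw [zpow_sub, h1, mul_inv_cancel]
  -- Modulo `p`, the exponent in `hcycle` is `e j - e (-j)`, by Fermat's little theorem.
  by_cases hsymm : ∃ j, ¬ (p : ℤ) ∣ e j - e (-j)
  · obtain ⟨j, hj⟩ := hsymm
    obtain ⟨g, hg, rfl⟩ := exists_mem_dirGroup_apply_eq Fact.out hgen hα he0 hs i h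
    refine eq_one_of_zpow_eq_one Fact.out (hpow1 _ _) ?_ (hcycle j i g hg)
    intro hd
    refine hj ?_
    rw [← ZMod.intCast_zmod_eq_zero_iff_dvd] at hd ⊢
    push_cast at hd ⊢
    rwa [ZMod.pow_card_pow, ZMod.pow_card_pow] at hd
  · push Not at hsymm
    have hstep : ∀ j, ¬ (p : ℤ) ∣ e j → ∀ i, ∀ g ∈ dirGroup α β e,
        v (i + j) (g (i + j)) = v i (g i) := by
      intro j hj i g hg
      rw [← div_eq_one]
      refine eq_one_of_zpow_eq_one (m := 1) Fact.out ?_ hj ?_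
      · rw [div_pow, hpow1, hpow1, div_one]
      · obtain ⟨t, ht⟩ := hsymm j
        rw [div_zpow, hrel i j g hg, div_eq_mul_inv, ← zpow_sub,
          show e (-j) - e j = p * (-t) by linarith, zpow_mul, zpow_natCast, hv, one_zpow]
    have hconst : ∀ c ∈ unitSupport p e, ∀ i, ∀ g ∈ dirGroup α β e,
        v (i + c) (g (i + c)) = v i (g i) := by
      intro c hc
      induction hc using AddSubgroup.closure_induction with
      | mem j hj => exact hstep j hj
      | zero => intro i g _; rw [add_zero]
      | add c c' _ _ hc hc' => intro i g hg; rw [← add_assoc, hc' _ g hg, hc _ g hg]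
      | neg c _ hc => intro i g hg; rw [← hc _ g hg, neg_add_cancel_right]
    obtain ⟨r, hr, hr3⟩ := card_unitSupport hp2 hι he0 hs
    have hsys : ∀ c k : unitSupport p e, c ≠ k →
        v i (dirTuple α β e (i + k) i) = v (i + c) α ^ e (c - k) := by
      intro c k hck
      rw [← hconst c c.2 i _ (dirTuple_mem _), dirTuple_of_ne, add_sub_add_left_eq_sub, map_zpow]
      intro h
      exact hck (Subtype.ext (add_left_cancel h))
    have hsol := eq_one_of_exponent_system hr hr3 (fun c : unitSupport p e => e c) he0
      (dvd_sum_unitSupport hsum) (fun k => v i (dirTuple α β e (i + k) i))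
      (fun c => v (i + c) α) (fun c => hv _ _) hsys
    have hvβ : v i β = 1 := by
      have := hsol 0
      rwa [show ((0 : unitSupport p e) : ι) = 0 from rfl, add_zero, dirTuple_self] at this
    have hvα : v i α = 1 := by
      refine eq_one_of_zpow_eq_one Fact.out (hpow1 _ _) hs ?_
      let s' : unitSupport p e := ⟨s, AddSubgroup.subset_closure hs⟩
      have hs' : (0 : unitSupport p e) ≠ -s' := by
        intro h
        have hs0 : s = 0 := congrArg Subtype.val (neg_eq_zero.1 h.symm)
        exact hs (by rw [hs0, he0]; exact dvd_zero _)
      have h1 := hsys 0 (-s') hs'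
      rw [hsol] at h1
      rw [show ((0 : unitSupport p e) : ι) = 0 from rfl, add_zero] at h1
      rw [h1]
      congr 2
      show s = 0 - -s
      rw [sub_neg_eq_add, zero_add]
    have hle : Subgroup.closure {α, β} ≤ (v i).ker := by
      rw [Subgroup.closure_le]
      rintro x (rfl | rfl)
      · exact hvα
      · exact hvβ
    exact hle (hgen ▸ Subgroup.mem_top h)

/-- The coordinate maps are trivial on `γ₃(A)` if the images of `γ₃(A)` agree along the cosets of
`unitSupport` and the maps kill the commutators `⁅⁅b, b'⁆, g⁆` with directed tuples `b`, `b'`. -/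
theorem map_gamma3_eq_one {p m n : ℕ} [Fact p.Prime] (hp2 : p ≠ 2) (hι : Fintype.card ι = p ^ n)
    (hgen : Subgroup.closure {α, β} = ⊤) (hα : α ^ p ^ m = 1) (he0 : e 0 = 0)
    (hsum : (p : ℤ) ∣ ∑ i, e i) {s : ι} (hs : ¬ (p : ℤ) ∣ e s)
    (Φ : CoordinateMaps (dirGroup α β e) V)
    (himage : ∀ c ∈ unitSupport p e, ∀ i, ∀ w ∈ gamma3 (⊤ : Subgroup A),
      ∃ w' ∈ gamma3 (⊤ : Subgroup A), Φ.φ i w = Φ.φ (i + c) w')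
    (hrel : ∀ i j, j ≠ 0 → ∀ g ∈ dirGroup α β e,
      Φ.φ i ⁅⁅β, α ^ e (-j)⁆, g i⁆ * Φ.φ (i + j) ⁅⁅α ^ e j, β⁆, g (i + j)⁆ = 1)
    (i : ι) {w : A} (hw : w ∈ gamma3 (⊤ : Subgroup A)) : Φ.φ i w = 1 := by
  have hfix := Φ.fixer_eq_top hp2 hι hgen hα he0 hsum hs himage
  have hrel' : ∀ i j, ∀ g ∈ dirGroup α β e, Φ.bracketHom (hfix (i + j)) α β (g (i + j)) ^ e j =
      Φ.bracketHom (hfix i) α β (g i) ^ e (-j) := by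
    intro i j g hg
    rcases eq_or_ne j 0 with rfl | hj
    · simp only [he0, neg_zero, zpow_zero]
    · have h1 := hrel i j hj g hg
      rw [← commutatorElement_inv (α ^ e (-j)) β, Φ.bracket_inv_left (hfix i) (commutator_mem_commutator_top _ _),
        Φ.bracket_zpow (hfix i), Φ.bracket_zpow (hfix (i + j))] at h1
      exact (inv_mul_eq_one.1 h1).symm
  -- Descend through the powers of `p`, so that the homomorphisms considered are `p`-torsion.
  have hdesc : ∀ r, (∀ i h, Φ.bracketHom (hfix i) α β h ^ p ^ r = 1) →
      ∀ i h, Φ.bracketHom (hfix i) α β h = 1 := by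
    intro r
    induction r with
    | zero => intro h i x; simpa using h i x
    | succ r ih =>
      intro h
      refine ih fun i x => ?_
      refine bracketHom_pow_eq_one hp2 hι hgen hα he0 hsum hs
        (fun i => (powMonoidHom (p ^ r)).comp (Φ.bracketHom (hfix i) α β)) ?_ ?_ i x
      · intro i x
        show (Φ.bracketHom (hfix i) α β x ^ p ^ r) ^ p = 1
        rw [← pow_mul, ← pow_succ, h]
      · intro i j g hg
        simp only [MonoidHom.comp_apply, powMonoidHom_apply]
        rw [← zpow_natCast, ← zpow_natCast, zpow_comm, hrel' i j g hg, zpow_comm]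
  refine Φ.map_gamma3_eq_one_of_bracketHom (hfix i) hgen (hdesc m ?_ i) hw
  intro i h
  rw [bracketHom_apply, ← zpow_natCast, ← Φ.bracket_zpow (hfix i), zpow_natCast, hα,
    commutatorElement_one_left, commutatorElement_one_left, Φ.map_one]

end CoordinateMaps

/-! ### The lower central series of the directed group -/

/-- The coordinate maps into the quotient, by a subgroup `Γ` normalised by `M`, of the direct product
of copies of the derived subgroup; the quotient is abelian if `Γ` contains the second derived
subgroup at each coordinate. -/
theorem exists_coordinateMaps.{u, v} {A : Type u} [Group A] {ι : Type v} [DecidableEq ι] [Finite ι]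
    {M Γ : Subgroup (ι → A)} (hM : M ≤ Subgroup.normalizer (Γ : Set (ι → A)))
    (hA : ∀ i, ∀ y ∈ commutator A, ∀ y' ∈ commutator A, Pi.mulSingle i ⁅y, y'⁆ ∈ Γ) :
    ∃ (V : Type (max v u)) (_ : CommGroup V) (Φ : CoordinateMaps M V),
      ∀ i i', ∀ w ∈ commutator A, ∀ w' ∈ commutator A,
        Φ.φ i w = Φ.φ i' w' ↔ (Pi.mulSingle i w)⁻¹ * Pi.mulSingle i' w' ∈ Γ := by
  classical
  let Y : Subgroup (ι → A) := Subgroup.pi Set.univ fun _ => commutator A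
  have hYΓ : ⁅Y, Y⁆ ≤ Γ := by
    refine (Subgroup.commutator_pi_pi_le _ _).trans ?_
    rw [Subgroup.pi_le_iff]
    intro i
    rw [Subgroup.map_le_iff_le_comap, Subgroup.commutator_le]
    exact fun y hy y' hy' => hA i y hy y' hy'
  have hle : commutator Y ≤ Γ.subgroupOf Y := by
    rw [commutator_def, Subgroup.commutator_le]
    intro x _ y _
    exact hYΓ (Subgroup.commutator_mem_commutator x.2 y.2)
  have hnormal : (Γ.subgroupOf Y).Normal := Subgroup.Normal.of_commutator_le _ hle
  have hcomm : IsMulCommutative (Y ⧸ Γ.subgroupOf Y) :=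
    Subgroup.Normal.quotient_commutative_iff_commutator_le.2 hle
  let instV : CommGroup (Y ⧸ Γ.subgroupOf Y) :=
    { (inferInstance : Group (Y ⧸ Γ.subgroupOf Y)) with mul_comm := hcomm.is_comm.comm }
  have hsingle : ∀ (i : ι) {x : A}, x ∈ commutator A → Pi.mulSingle i x ∈ Y := by
    intro i x hx k _
    rw [Pi.mulSingle_apply]
    split_ifs
    · exact hx
    · exact (commutator A).one_mem
  let φ : ι → A → Y ⧸ Γ.subgroupOf Y := fun i x =>
    if hx : x ∈ commutator A then ((⟨Pi.mulSingle i x, hsingle i hx⟩ : Y) : Y ⧸ Γ.subgroupOf Y)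
    else 1
  have hφ : ∀ (i : ι) {x : A} (hx : x ∈ commutator A),
      φ i x = ((⟨Pi.mulSingle i x, hsingle i hx⟩ : Y) : Y ⧸ Γ.subgroupOf Y) :=
    fun i x hx => dif_pos hx
  have hiff : ∀ i i', ∀ w ∈ commutator A, ∀ w' ∈ commutator A,
      φ i w = φ i' w' ↔ (Pi.mulSingle i w)⁻¹ * Pi.mulSingle i' w' ∈ Γ := by
    intro i i' w hw w' hw'
    rw [hφ i hw, hφ i' hw', QuotientGroup.eq]
    rfl
  refine ⟨Y ⧸ Γ.subgroupOf Y, instV, ⟨φ, ?_, ?_⟩, hiff⟩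
  · intro i x hx y hy
    rw [hφ i hx, hφ i hy, hφ i (mul_mem hx hy), ← QuotientGroup.mk_mul]
    congr 1
    exact Subtype.ext (Pi.mulSingle_mul (f := fun _ => A) i x y)
  · intro g hg i i' w hw w' hw' h
    rw [hiff i i' w hw w' hw'] at h
    rw [hiff i i' _ (Subgroup.Normal.conj_mem inferInstance _ hw _) _
      (Subgroup.Normal.conj_mem inferInstance _ hw' _), ← mulSingle_conj, ← mulSingle_conj]
    have h' := (Subgroup.mem_normalizer_iff.1 (hM hg) _).1 h
    have : (g * Pi.mulSingle i w * g⁻¹)⁻¹ * (g * Pi.mulSingle i' w' * g⁻¹) =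
        g * ((Pi.mulSingle i w)⁻¹ * Pi.mulSingle i' w') * g⁻¹ := by group
    rw [this]
    exact h'

theorem apply_mem_of_mem_commutator {A ι : Type*} [Group A] {M : Subgroup (ι → A)} {g : ι → A} (hg : g ∈ ⁅M, M⁆) (i : ι) :
    g i ∈ commutator A := by
  have h : ⁅M, M⁆ ≤ (commutator A).comap (Pi.evalMonoidHom (fun _ => A) i) := by
    rw [Subgroup.commutator_le]
    exact fun x _ y _ => commutator_mem_commutator_top (x i) (y i)
  exact h hg

theorem gamma3_le_pi {A ι : Type*} [Group A] (M : Subgroup (ι → A)) :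
    gamma3 M ≤ Subgroup.pi Set.univ fun _ => gamma3 (⊤ : Subgroup A) := by
  intro g hg i _
  have h : gamma3 M ≤ (gamma3 (⊤ : Subgroup A)).comap (Pi.evalMonoidHom (fun _ => A) i) := by
    refine Subgroup.commutator_le.2 fun x hx y _ => ?_
    exact commutator_mem_gamma3_top (apply_mem_of_mem_commutator hx i) (y i)
  exact h hg

theorem commutator_mem_gamma3 {G : Type*} [Group G] {M : Subgroup G} {x y : G} (hx : x ∈ ⁅M, M⁆)
    (hy : y ∈ M) : ⁅x, y⁆ ∈ gamma3 M :=
  Subgroup.commutator_mem_commutator hx hy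

theorem commutator_self_le {G : Type*} [Group G] (M : Subgroup G) : ⁅M, M⁆ ≤ M := by
  rw [Subgroup.commutator_le]
  exact fun x hx y hy => mul_mem (mul_mem (mul_mem hx hy) (inv_mem hx)) (inv_mem hy)

section DirGroup

variable {A : Type*} [Group A] {ι : Type*} [AddCommGroup ι] [DecidableEq ι]
  {α β : A} {e : ι → ℤ}

theorem pairTuple_mem_commutator {j : ι} (hj : j ≠ 0) (i : ι) :
    pairTuple i (i + j) ⁅β, α ^ e (-j)⁆ ⁅α ^ e j, β⁆ ∈ ⁅dirGroup α β e, dirGroup α β e⁆ := by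
  rw [← dirTuple_commutator hj]
  exact Subgroup.commutator_mem_commutator (dirTuple_mem _) (dirTuple_mem _)

/-- Every element of the derived subgroup of `A` is the `i`-th entry of an element of the derived
subgroup of the directed group with at most one other non-trivial entry, at `i - j`. -/
theorem exists_pairTuple_mem {p m : ℕ} (hp : p.Prime) (hgen : Subgroup.closure {α, β} = ⊤)
    (hα : α ^ p ^ m = 1) (he0 : e 0 = 0) {j : ι} (hj : ¬ (p : ℤ) ∣ e j) (i : ι) {y : A}
    (hy : y ∈ commutator A) :
    ∃ x, pairTuple (i - j) i x y ∈ ⁅dirGroup α β e, dirGroup α β e⁆ := by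
  let T : Subgroup A :=
    { carrier := {y | ∃ x, pairTuple (i - j) i x y ∈ ⁅dirGroup α β e, dirGroup α β e⁆}
      one_mem' := ⟨1, by rw [pairTuple_one]; exact one_mem _⟩
      mul_mem' := by
        rintro y y' ⟨x, hx⟩ ⟨x', hx'⟩
        exact ⟨x * x', by rw [← pairTuple_mul]; exact mul_mem hx hx'⟩
      inv_mem' := by
        rintro y ⟨x, hx⟩
        exact ⟨x⁻¹, by rw [← pairTuple_inv]; exact inv_mem hx⟩ }
  have hT : T.Normal := by
    refine ⟨?_⟩
    rintro y ⟨x, hx⟩ h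
    obtain ⟨g, hg, rfl⟩ := exists_mem_dirGroup_apply_eq hp hgen hα he0 hj i h
    refine ⟨g (i - j) * x * (g (i - j))⁻¹, ?_⟩
    rw [← pairTuple_conj]
    exact (Subgroup.mem_normalizer_iff.1 (Subgroup.normalizer_commutator_ge_left _ _ hg) _).1 hx
  have hj0 : j ≠ 0 := by
    rintro rfl
    exact hj (he0 ▸ dvd_zero _)
  have hgen' : Subgroup.closure {α ^ e j, β} = ⊤ := by
    rw [eq_top_iff, ← hgen, Subgroup.closure_le]
    rintro x (rfl | rfl)
    · obtain ⟨r, hr⟩ := exists_zpow_zpow_eq hp hα hj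
      have h := zpow_mem (Subgroup.subset_closure (Set.mem_insert (x ^ e j) {β})) r
      rwa [hr] at h
    · exact Subgroup.subset_closure (Set.mem_insert_of_mem _ rfl)
  refine commutator_le_of_generators hgen' T ⟨⁅β, α ^ e (-j)⁆, ?_⟩ hy
  have h := pairTuple_mem_commutator (α := α) (β := β) (e := e) hj0 (i - j)
  rwa [sub_add_cancel] at h

/-- The commutator of two pairs which overlap in one position only is concentrated there; hence the
third term of the lower central series of the directed group contains the second derived subgroup
of `A` at each coordinate. -/
theorem mulSingle_commutator_mem {p m : ℕ} (hp : p.Prime) (hgen : Subgroup.closure {α, β} = ⊤)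
    (hα : α ^ p ^ m = 1) (he0 : e 0 = 0) {j : ι} (hj : ¬ (p : ℤ) ∣ e j) (hjj : -j ≠ j) (i : ι)
    {y y' : A} (hy : y ∈ commutator A) (hy' : y' ∈ commutator A) :
    Pi.mulSingle i ⁅y, y'⁆ ∈ gamma3 (dirGroup α β e) := by
  have hexists := fun i {y : A} (hy : y ∈ commutator A) =>
    exists_pairTuple_mem (β := β) hp hgen hα he0 hj i hy
  have hj0 : j ≠ 0 := by
    rintro rfl
    exact hj (he0 ▸ dvd_zero _)
  have hcomm : ∀ {x y : ι → A}, x ∈ ⁅dirGroup α β e, dirGroup α β e⁆ →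
      y ∈ ⁅dirGroup α β e, dirGroup α β e⁆ → ⁅x, y⁆ ∈ gamma3 (dirGroup α β e) :=
    fun hx hy => commutator_mem_gamma3 hx (commutator_self_le _ hy)
  -- Two pairs, at `i - j, i` and at `i, i + j`, overlap only at `i`.
  have hfirst : ∀ (i : ι) {y x' y' : A}, y ∈ commutator A →
      pairTuple i (i + j) x' y' ∈ ⁅dirGroup α β e, dirGroup α β e⁆ →
      Pi.mulSingle i ⁅y, x'⁆ ∈ gamma3 (dirGroup α β e) := by
    intro i y x' y' hy h
    obtain ⟨x, hx⟩ := hexists i hy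
    have h1 := hcomm hx h
    have hne : i - j ≠ i := fun h => hj0 (sub_eq_self.1 h)
    have hne' : i - j ≠ i + j := fun h => hjj (add_left_cancel (by rwa [← sub_eq_add_neg]))
    have hv : pairTuple i (i + j) x' y' (i - j) = 1 := by
      rw [pairTuple, if_neg hne, if_neg hne']
    have hv' : pairTuple i (i + j) x' y' i = x' := if_pos rfl
    rwa [pairTuple_commutator, hv, hv', commutatorElement_one_right, pairTuple_one_left hne] at h1
  obtain ⟨x, hx⟩ := hexists i hy
  obtain ⟨x', hx'⟩ := hexists i hy'
  have hne : i - j ≠ i := fun h => hj0 (sub_eq_self.1 h)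
  have hxmem : x ∈ commutator A := by
    have h := apply_mem_of_mem_commutator hx (i - j)
    rwa [pairTuple, if_pos rfl] at h
  have h1 : Pi.mulSingle (i - j) ⁅x, x'⁆ ∈ gamma3 (dirGroup α β e) :=
    hfirst (i - j) (y' := y') hxmem (by rwa [sub_add_cancel])
  have h2 := hcomm hx hx'
  have hv : pairTuple (i - j) i x' y' (i - j) = x' := if_pos rfl
  have hv' : pairTuple (i - j) i x' y' i = y' := by
    rw [pairTuple, if_neg hne.symm, if_pos rfl]
  rw [pairTuple_commutator, hv, hv', pairTuple_eq_mul hne] at h2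
  exact (Subgroup.mul_mem_cancel_left _ h1).1 h2

/-- Modulo the third term of the lower central series of the directed group, each element of
`γ₃(A)` at the coordinate `i` is equal to one at the coordinate `i - j`. -/
theorem exists_mulSingle_inv_mul_mem {p m : ℕ} (hp : p.Prime)
    (hgen : Subgroup.closure {α, β} = ⊤) (hα : α ^ p ^ m = 1) (he0 : e 0 = 0) {j : ι}
    (hj : ¬ (p : ℤ) ∣ e j) (i : ι) {w : A} (hw : w ∈ gamma3 (⊤ : Subgroup A)) :
    ∃ w' ∈ gamma3 (⊤ : Subgroup A),
      (Pi.mulSingle i w)⁻¹ * Pi.mulSingle (i - j) w' ∈ gamma3 (dirGroup α β e) := by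
  have hj0 : j ≠ 0 := by
    rintro rfl
    exact hj (he0 ▸ dvd_zero _)
  have hne : i - j ≠ i := fun h => hj0 (sub_eq_self.1 h)
  let T : Subgroup A :=
    { carrier := {y | ∃ x, pairTuple (i - j) i x y ∈ gamma3 (dirGroup α β e)}
      one_mem' := ⟨1, by rw [pairTuple_one]; exact one_mem _⟩
      mul_mem' := by
        rintro y y' ⟨x, hx⟩ ⟨x', hx'⟩
        exact ⟨x * x', by rw [← pairTuple_mul]; exact mul_mem hx hx'⟩
      inv_mem' := by
        rintro y ⟨x, hx⟩
        exact ⟨x⁻¹, by rw [← pairTuple_inv]; exact inv_mem hx⟩ }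
  have hT : gamma3 (⊤ : Subgroup A) ≤ T := by
    refine Subgroup.commutator_le.2 fun y hy h _ => ?_
    obtain ⟨x, hx⟩ := exists_pairTuple_mem (β := β) hp hgen hα he0 hj i hy
    obtain ⟨g, hg, rfl⟩ := exists_mem_dirGroup_apply_eq hp hgen hα he0 hj i h
    refine ⟨⁅x, g (i - j)⁆, ?_⟩
    rw [← pairTuple_commutator]
    exact commutator_mem_gamma3 hx hg
  obtain ⟨x, hx⟩ := hT hw
  have hxmem := gamma3_le_pi _ hx (i - j) trivial
  rw [pairTuple, if_pos rfl] at hxmem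
  refine ⟨x⁻¹, inv_mem hxmem, ?_⟩
  rw [Pi.mulSingle_inv, ← mul_inv_rev, ← pairTuple_eq_mul hne]
  exact inv_mem hx

/-- The directed tuples generate a group whose third term of the lower central series is the full
direct product of copies of `γ₃(A)`. -/
theorem gamma3_dirGroup [Fintype ι] {p m n : ℕ} [Fact p.Prime] (hp2 : p ≠ 2)
    (hι : Fintype.card ι = p ^ n) (hgen : Subgroup.closure {α, β} = ⊤) (hα : α ^ p ^ m = 1)
    (he0 : e 0 = 0) (hsum : (p : ℤ) ∣ ∑ i, e i) {s : ι} (hs : ¬ (p : ℤ) ∣ e s) :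
    gamma3 (dirGroup α β e) = Subgroup.pi Set.univ fun _ => gamma3 (⊤ : Subgroup A) := by
  have hp : p.Prime := Fact.out
  refine le_antisymm (gamma3_le_pi _) ?_
  -- The order of `ι` is odd.
  have hneg : ∀ j : ι, j ≠ 0 → -j ≠ j := by
    intro j hj h
    have h2 : 2 • j = 0 := by rw [two_nsmul]; nth_rewrite 1 [← h]; exact neg_add_cancel j
    have hcard : p ^ n • j = 0 := by rw [← hι]; exact card_nsmul_eq_zero
    have hco : Nat.Coprime 2 (p ^ n) :=
      Nat.Coprime.pow_right _ ((Nat.coprime_primes Nat.prime_two hp).2 hp2.symm)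
    have h1 := Nat.dvd_gcd (addOrderOf_dvd_of_nsmul_eq_zero h2)
      (addOrderOf_dvd_of_nsmul_eq_zero hcard)
    rw [hco.gcd_eq_one, Nat.dvd_one, AddMonoid.addOrderOf_eq_one_iff] at h1
    exact hj h1
  have hs0 : s ≠ 0 := by
    rintro rfl
    exact hs (he0 ▸ dvd_zero _)
  obtain ⟨V, _, Φ, hΦ⟩ := exists_coordinateMaps (M := dirGroup α β e)
    (Γ := gamma3 (dirGroup α β e)) (Subgroup.normalizer_commutator_ge_right _ _)
    (fun i y hy y' hy' => mulSingle_commutator_mem hp hgen hα he0 hs (hneg s hs0) i hy hy')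
  have hΦ' : ∀ i, ∀ w ∈ commutator A, Φ.φ i w = 1 ↔
      Pi.mulSingle i w ∈ gamma3 (dirGroup α β e) := by
    intro i w hw
    rw [← Φ.map_one i, hΦ i i w hw 1 (one_mem _), Pi.mulSingle_one, mul_one, inv_mem_iff]
  have hunit : ∀ j, ¬ (p : ℤ) ∣ e j → ∀ i, ∀ w ∈ gamma3 (⊤ : Subgroup A),
      ∃ w' ∈ gamma3 (⊤ : Subgroup A), Φ.φ i w = Φ.φ (i - j) w' := by
    intro j hj i w hw
    obtain ⟨w', hw', h⟩ := exists_mulSingle_inv_mul_mem (β := β) hp hgen hα he0 hj i hw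
    exact ⟨w', hw', (hΦ _ _ _ (gamma3_le_commutator_top hw) _ (gamma3_le_commutator_top hw')).2 h⟩
  -- The index group is finite, so negatives are obtained from repeated addition.
  have hmul : ∀ c, (∀ i, ∀ w ∈ gamma3 (⊤ : Subgroup A),
      ∃ w' ∈ gamma3 (⊤ : Subgroup A), Φ.φ i w = Φ.φ (i + c) w') → ∀ k : ℕ, ∀ i,
      ∀ w ∈ gamma3 (⊤ : Subgroup A),
      ∃ w' ∈ gamma3 (⊤ : Subgroup A), Φ.φ i w = Φ.φ (i + k • c) w' := by
    intro c hc k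
    induction k with
    | zero => intro i w hw; exact ⟨w, hw, by rw [zero_smul, add_zero]⟩
    | succ k ih =>
      intro i w hw
      obtain ⟨w', hw', h⟩ := ih i w hw
      obtain ⟨w'', hw'', h'⟩ := hc _ w' hw'
      exact ⟨w'', hw'', by rw [h, h', succ_nsmul, add_assoc]⟩
  have hneg_smul : ∀ c : ι, (Fintype.card ι - 1) • c = -c := by
    intro c
    rw [eq_neg_iff_add_eq_zero, ← succ_nsmul, Nat.sub_add_cancel Fintype.card_pos,
      card_nsmul_eq_zero]
  have himage : ∀ c ∈ unitSupport p e, ∀ i, ∀ w ∈ gamma3 (⊤ : Subgroup A),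
      ∃ w' ∈ gamma3 (⊤ : Subgroup A), Φ.φ i w = Φ.φ (i + c) w' := by
    intro c hc
    induction hc using AddSubgroup.closure_induction with
    | mem j hj =>
      have h := hmul (-j) (fun i w hw => by
        simpa only [sub_eq_add_neg] using hunit j hj i w hw) (Fintype.card ι - 1)
      rwa [hneg_smul, neg_neg] at h
    | zero => exact fun i w hw => ⟨w, hw, by rw [add_zero]⟩
    | add c c' _ _ hc hc' =>
      intro i w hw
      obtain ⟨w', hw', h⟩ := hc i w hw
      obtain ⟨w'', hw'', h'⟩ := hc' _ w' hw'
      exact ⟨w'', hw'', by rw [h, h', add_assoc]⟩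
    | neg c _ hc =>
      have h := hmul c hc (Fintype.card ι - 1)
      rwa [hneg_smul] at h
  rw [Subgroup.pi_le_iff]
  rintro i _ ⟨w, hw, rfl⟩
  refine (hΦ' i w (gamma3_le_commutator_top hw)).1
    (Φ.map_gamma3_eq_one hp2 hι hgen hα he0 hsum hs himage ?_ i hw)
  intro i j hj g hg
  have hne : i ≠ i + j := by simpa using hj
  have h1 := commutator_mem_gamma3 (pairTuple_mem_commutator (α := α) (β := β) (e := e) hj i) hg
  rw [pairTuple_commutator, pairTuple_eq_mul hne] at h1
  rw [← inv_inv (Φ.φ i _), inv_mul_eq_one, ← Φ.map_inv i (commutator_mem_commutator_top _ _),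
    hΦ _ _ _ (inv_mem (commutator_mem_commutator_top _ _)) _ (commutator_mem_commutator_top _ _),
    Pi.mulSingle_inv, inv_inv]
  exact h1

end DirGroup

/-! ### Vertices, sections and stabilisers -/

variable {d : ℕ → ℕ}

namespace Vertex

theorem le {n k : ℕ} (v : Vertex d n k) : n ≤ k := by
  induction v with
  | nil n => exact le_rfl
  | cons x v ih => omega

theorem eq_nil {n : ℕ} (v : Vertex d n n) : v = nil n := by
  cases v with
  | nil => rfl
  | cons x v => exact absurd v.le (by omega)

theorem eq_cons {n k : ℕ} (h : n < k) (v : Vertex d n k) :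
    ∃ (x : Fin (d n)) (w : Vertex d (n + 1) k), v = cons x w := by
  cases v with
  | nil => omega
  | cons x v => exact ⟨x, v, rfl⟩

/-- The vertex of the first layer of `T_n` with letter `x`. -/
def single {n : ℕ} (x : Fin (d n)) : Vertex d n (n + 1) := cons x (nil (n + 1))

theorem single_injective {n : ℕ} : Function.Injective (single : Fin (d n) → Vertex d n (n + 1)) := by
  intro x y h
  simp only [single, cons.injEq, and_true] at h
  exact h

theorem single_surjective {n : ℕ} :
    Function.Surjective (single : Fin (d n) → Vertex d n (n + 1)) := by
  intro v
  obtain ⟨x, w, rfl⟩ := eq_cons (Nat.lt_succ_self n) v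
  exact ⟨x, by rw [single, w.eq_nil]⟩

/-- The letters of the alphabet `Fin (d n)` as vertices of the first layer of `T_n`. -/
noncomputable def singleEquiv (d : ℕ → ℕ) (n : ℕ) : Fin (d n) ≃ Vertex d n (n + 1) :=
  Equiv.ofBijective single ⟨single_injective, single_surjective⟩

theorem exists_append {n l : ℕ} (w : Vertex d n l) :
    ∀ {k : ℕ}, n ≤ k → k ≤ l → ∃ (u : Vertex d n k) (v : Vertex d k l), w = u.append v := by
  induction w with
  | nil n =>
    intro k h1 h2
    obtain rfl : k = n := le_antisymm h2 h1
    exact ⟨nil k, nil k, rfl⟩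
  | @cons n l x w ih =>
    intro k h1 h2
    rcases h1.eq_or_lt with rfl | h1
    · exact ⟨nil n, cons x w, rfl⟩
    · obtain ⟨u, v, rfl⟩ := ih h1 h2
      exact ⟨cons x u, v, rfl⟩

theorem append_inj {n k l : ℕ} {u u' : Vertex d n k} {v v' : Vertex d k l}
    (h : u.append v = u'.append v') : u = u' ∧ v = v' := by
  have hu : u = u' := by
    induction u with
    | nil n => exact (eq_nil u').symm
    | cons x u ih =>
      obtain ⟨x', w', rfl⟩ := eq_cons (Nat.lt_of_succ_le u.le) u'
      simp only [append, cons.injEq] at h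
      rw [h.1, ih h.2]
  subst hu
  exact ⟨rfl, append_left_cancel u h⟩

theorem nonempty (hd : ∀ i, 0 < d i) {n k : ℕ} (h : n ≤ k) : Nonempty (Vertex d n k) := by
  induction k, h using Nat.le_induction with
  | base => exact ⟨nil n⟩
  | succ k h ih =>
    obtain ⟨v⟩ := ih
    exact ⟨v.append (single ⟨0, hd k⟩)⟩

instance {n k : ℕ} : Finite (Vertex d n k) := by
  rcases lt_or_ge k n with h | h
  · have : IsEmpty (Vertex d n k) := ⟨fun v => absurd v.le (by omega)⟩
    infer_instance
  · induction k, h using Nat.le_induction with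
    | base => exact @Finite.of_subsingleton _ ⟨fun u v => by rw [u.eq_nil, v.eq_nil]⟩
    | succ k h ih =>
      refine Finite.of_surjective
        (fun x : Vertex d n k × Fin (d k) => x.1.append (single x.2)) ?_
      intro w
      obtain ⟨u, v, rfl⟩ := w.exists_append h (Nat.le_succ k)
      obtain ⟨x, rfl⟩ := single_surjective v
      exact ⟨(u, x), rfl⟩

end Vertex

theorem treeAut_ext {n : ℕ} {f g : treeAut d n} (h : ∀ l (v : Vertex d n l), f.1 l v = g.1 l v) :
    f = g :=
  Subtype.ext (funext fun l => Equiv.ext (h l))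

theorem sectionAt_mul {n k : ℕ} (f g : treeAut d n) (u : Vertex d n k) :
    sectionAt (f * g) u = sectionAt f (g.1 k u) * sectionAt g u := by
  refine sectionAt_ext fun l v => ?_
  show f.1 l (g.1 l (u.append v)) = (f.1 k (g.1 k u)).append _
  rw [sectionAt_spec, sectionAt_spec]
  rfl

theorem sectionAt_one {n k : ℕ} (u : Vertex d n k) : sectionAt (1 : treeAut d n) u = 1 :=
  sectionAt_ext fun _ _ => rfl

theorem sectionAt_inv {n k : ℕ} (f : treeAut d n) (u : Vertex d n k) :
    sectionAt f⁻¹ u = (sectionAt f (f⁻¹.1 k u))⁻¹ := by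
  refine eq_inv_of_mul_eq_one_right ?_
  rw [← sectionAt_mul, mul_inv_cancel, sectionAt_one]

theorem sectionAt_append {n k l : ℕ} (f : treeAut d n) (u : Vertex d n k) (v : Vertex d k l) :
    sectionAt f (u.append v) = sectionAt (sectionAt f u) v := by
  refine sectionAt_ext fun j w => ?_
  rw [Vertex.append_assoc, sectionAt_spec, sectionAt_spec, sectionAt_spec, Vertex.append_assoc]

theorem sectionAt_nil {n : ℕ} (f : treeAut d n) : sectionAt f (.nil n) = f :=
  sectionAt_ext fun l v => by rw [Vertex.eq_nil (f.1 n (.nil n))]; rfl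

theorem apply_append {n k l : ℕ} {f : treeAut d n} {u : Vertex d n k} (h : f.1 k u = u)
    (v : Vertex d k l) : f.1 l (u.append v) = u.append ((sectionAt f u).1 l v) := by
  rw [sectionAt_spec, h]

theorem mem_levelStab {n k : ℕ} {f : treeAut d n} :
    f ∈ levelStab d n k ↔ ∀ v : Vertex d n k, f.1 k v = v := Iff.rfl

theorem mem_psiImage {n k : ℕ} {H : Subgroup (treeAut d n)} {g : Vertex d n k → treeAut d k} :
    g ∈ psiImage H k ↔ ∃ f ∈ H, f ∈ levelStab d n k ∧ ∀ u, sectionAt f u = g u := by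
  constructor
  · rintro ⟨f, hf, rfl⟩
    exact ⟨f, hf, f.2, fun _ => rfl⟩
  · rintro ⟨f, hf, hf', h⟩
    exact ⟨⟨f, hf'⟩, hf, funext h⟩

theorem psiImage_mono {n : ℕ} {H K : Subgroup (treeAut d n)} (h : H ≤ K) (k : ℕ) :
    psiImage H k ≤ psiImage K k := by
  intro g hg
  obtain ⟨f, hf, h'⟩ := mem_psiImage.1 hg
  exact mem_psiImage.2 ⟨f, h hf, h'⟩

theorem mem_levelProd {n k : ℕ} {K : Subgroup (treeAut d k)} {g : Vertex d n k → treeAut d k} :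
    g ∈ levelProd n K ↔ ∀ u, g u ∈ K :=
  ⟨fun h u => h u trivial, fun h u _ => h u⟩

/-- An automorphism that fixes a vertex fixes its prefixes. -/
theorem apply_eq_of_apply_append_eq {n k l : ℕ} {f : treeAut d n} {u : Vertex d n k}
    {v : Vertex d k l} (h : f.1 l (u.append v) = u.append v) : f.1 k u = u := by
  rw [sectionAt_spec] at h
  exact (Vertex.append_inj h).1

theorem apply_eq_of_le {n k l : ℕ} (hd : ∀ i, 0 < d i) {f : treeAut d n}
    (hf : f ∈ levelStab d n k) (hl : l ≤ k) (v : Vertex d n l) : f.1 l v = v := by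
  obtain ⟨w⟩ := Vertex.nonempty hd hl
  exact apply_eq_of_apply_append_eq (hf (v.append w))

/-- An element of the stabiliser of level `k` is determined by its sections at level `k`. -/
theorem eq_of_sectionAt_eq {n k : ℕ} (hd : ∀ i, 0 < d i) (hk : n ≤ k) {f g : treeAut d n}
    (hf : f ∈ levelStab d n k) (hg : g ∈ levelStab d n k)
    (h : ∀ u : Vertex d n k, sectionAt f u = sectionAt g u) : f = g := by
  refine treeAut_ext fun l v => ?_
  rcases le_total l k with hl | hl
  · rw [apply_eq_of_le hd hf hl, apply_eq_of_le hd hg hl]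
  · obtain ⟨u, w, rfl⟩ := v.exists_append hk hl
    rw [apply_append (hf u), apply_append (hg u), h]

theorem mem_levelStab_of_sectionAt {n k l : ℕ} (hk : n ≤ k) (hl : k ≤ l) {f : treeAut d n}
    (hf : f ∈ levelStab d n k) (h : ∀ u : Vertex d n k, sectionAt f u ∈ levelStab d k l) :
    f ∈ levelStab d n l := by
  intro v
  obtain ⟨u, w, rfl⟩ := v.exists_append hk hl
  rw [apply_append (hf u), h u w]

/-- An element of the stabiliser of level `k` with at most one non-trivial section lies in a rigid
vertex stabiliser. -/
theorem mem_rigidStab {n k : ℕ} (hd : ∀ i, 0 < d i) (hk : n ≤ k) {G : Subgroup (treeAut d n)}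
    {f : treeAut d n} (hfG : f ∈ G) (hf : f ∈ levelStab d n k) {u : Vertex d n k}
    (h : ∀ v, v ≠ u → sectionAt f v = 1) : f ∈ rigidStab G u := by
  refine ⟨hfG, fun l v hv => ?_⟩
  rcases le_total l k with hl | hl
  · exact apply_eq_of_le hd hf hl v
  · obtain ⟨u', w, rfl⟩ := v.exists_append hk hl
    rw [apply_append (hf u'), h u' fun h' => hv ⟨w, by rw [h']⟩]
    rfl

/-- The automorphisms of `T_n` all of whose sections at level `k` lie in `K`. -/
def sectionsIn (n : ℕ) {k : ℕ} (K : Subgroup (treeAut d k)) : Subgroup (treeAut d n) where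
  carrier := {f | ∀ u : Vertex d n k, sectionAt f u ∈ K}
  one_mem' := fun u => by rw [sectionAt_one]; exact one_mem _
  mul_mem' := fun hf hg u => by rw [sectionAt_mul]; exact mul_mem (hf _) (hg _)
  inv_mem' := fun hf u => by rw [sectionAt_inv]; exact inv_mem (hf _)

/-! ### The generators -/

/-- The rooted automorphisms of `T_n`, as a homomorphism on the permutations of the first layer. -/
def rootedHom (d : ℕ → ℕ) (n : ℕ) : Equiv.Perm (Fin (d n)) →* treeAut d n where
  toFun := rooted
  map_one' := treeAut_ext fun _ v => rootedFun_one v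
  map_mul' := fun σ τ => treeAut_ext fun _ v => rootedFun_mul σ τ v

theorem rootedHom_apply {n : ℕ} (σ : Equiv.Perm (Fin (d n))) : rootedHom d n σ = rooted σ := rfl

theorem genA_zpow {n : ℕ} (t : ℤ) : genA d n ^ t = rooted (finRotate (d n) ^ t) :=
  (map_zpow (rootedHom d n) _ t).symm

theorem rooted_apply_single {n : ℕ} (σ : Equiv.Perm (Fin (d n))) (x : Fin (d n)) :
    (rooted σ).1 (n + 1) (.single x) = .single (σ x) := rfl

theorem sectionAt_rooted_single {n : ℕ} (σ : Equiv.Perm (Fin (d n))) (x : Fin (d n)) :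
    sectionAt (rooted σ) (.single x) = 1 :=
  sectionAt_ext fun _ _ => rfl

theorem rooted_eq_one_iff {n : ℕ} {σ : Equiv.Perm (Fin (d n))} :
    (rooted σ : treeAut d n) = 1 ↔ σ = 1 := by
  constructor
  · intro h
    refine Equiv.ext fun x => Vertex.single_injective ?_
    rw [← rooted_apply_single, h]
    rfl
  · rintro rfl
    exact map_one (rootedHom d n)

theorem genB_apply_single (e : ℕ → ℤ) {n : ℕ} (x : Fin (d n)) :
    (genB d e n).1 (n + 1) (.single x) = .single x := by
  show dirFun e (.single x) = _
  rw [Vertex.single, dirFun]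
  split_ifs <;> rfl

theorem genB_mem_levelStab (e : ℕ → ℤ) (n : ℕ) : genB d e n ∈ levelStab d n (n + 1) := by
  intro v
  obtain ⟨x, rfl⟩ := Vertex.single_surjective v
  exact genB_apply_single e x

theorem sectionAt_genB_last (e : ℕ → ℤ) {n : ℕ} {x : Fin (d n)} (hx : x.val + 1 = d n) :
    sectionAt (genB d e n) (.single x) = genB d e (n + 1) := by
  refine sectionAt_ext fun l v => ?_
  rw [genB_apply_single]
  show dirFun e (.cons x v) = .cons x (dirFun e v)
  rw [dirFun, if_pos hx]

theorem sectionAt_genB (e : ℕ → ℤ) {n : ℕ} {x : Fin (d n)} (hx : x.val + 1 ≠ d n) :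
    sectionAt (genB d e n) (.single x) = rooted (dirLabel d e n (x.val + 1)) := by
  refine sectionAt_ext fun l v => ?_
  rw [genB_apply_single]
  show dirFun e (.cons x v) = .cons x (rootedFun _ v)
  rw [dirFun, if_neg hx]

theorem genA_mem (e : ℕ → ℤ) (n : ℕ) : genA d n ∈ ggs d e n :=
  Subgroup.subset_closure (Set.mem_insert _ _)

theorem genB_mem (e : ℕ → ℤ) (n : ℕ) : genB d e n ∈ ggs d e n :=
  Subgroup.subset_closure (Set.mem_insert_of_mem _ rfl)

theorem rooted_dirLabel_mem (e : ℕ → ℤ) (n j : ℕ) :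
    rooted (dirLabel d e n j) ∈ ggs d e (n + 1) := by
  rw [dirLabel]
  split_ifs
  · rw [← genA_zpow]
    exact zpow_mem (genA_mem e _) _
  · rw [rooted_eq_one_iff.2 rfl]
    exact one_mem _

theorem ggs_le_sectionsIn_iff (e : ℕ → ℤ) {n : ℕ} {K : Subgroup (treeAut d (n + 1))} :
    ggs d e n ≤ sectionsIn n K ↔ genB d e n ∈ sectionsIn n K := by
  rw [ggs, Subgroup.closure_le, Set.insert_subset_iff, Set.singleton_subset_iff]
  refine and_iff_right fun v => ?_
  obtain ⟨x, rfl⟩ := Vertex.single_surjective v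
  rw [genA, sectionAt_rooted_single]
  exact one_mem _

theorem ggs_le_sectionsIn_succ (e : ℕ → ℤ) (n : ℕ) :
    ggs d e n ≤ sectionsIn n (ggs d e (n + 1)) := by
  rw [ggs_le_sectionsIn_iff]
  intro v
  obtain ⟨x, rfl⟩ := Vertex.single_surjective v
  by_cases hx : x.val + 1 = d n
  · rw [sectionAt_genB_last e hx]
    exact genB_mem e _
  · rw [sectionAt_genB e hx]
    exact rooted_dirLabel_mem e n _

theorem ggs_le_sectionsIn (e : ℕ → ℤ) {n k : ℕ} (h : n ≤ k) :
    ggs d e n ≤ sectionsIn n (ggs d e k) := by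
  induction k, h using Nat.le_induction with
  | base =>
    intro f hf u
    rwa [u.eq_nil, sectionAt_nil]
  | succ k h ih =>
    intro f hf w
    obtain ⟨u, v, rfl⟩ := w.exists_append h (Nat.le_succ k)
    rw [sectionAt_append]
    exact ggs_le_sectionsIn_succ e k (ih hf u) v

/-! ### Functoriality of `γ₃` -/

theorem map_gamma3 {G G' : Type*} [Group G] [Group G'] (f : G →* G') (H : Subgroup G) :
    (gamma3 H).map f = gamma3 (H.map f) := by
  rw [gamma3, gamma3, Subgroup.map_commutator, Subgroup.map_commutator]

theorem gamma3_mono {G : Type*} [Group G] {H K : Subgroup G} (h : H ≤ K) : gamma3 H ≤ gamma3 K :=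
  Subgroup.commutator_mono (Subgroup.commutator_mono h h) h

theorem gamma3_le_self {G : Type*} [Group G] (H : Subgroup G) : gamma3 H ≤ H :=
  Subgroup.commutator_le.2 fun _ hx _ hy =>
    commutator_self_le H
      (Subgroup.commutator_mem_commutator (commutator_self_le H hx) hy)

/-- Relative form of `gamma3_dirGroup`, for two elements of an ambient group. -/
theorem gamma3_dirGroup_closure {B : Type*} [Group B] {α β : B} {ι : Type*} [AddCommGroup ι]
    [DecidableEq ι] [Fintype ι] {e : ι → ℤ} {p m n : ℕ} [Fact p.Prime] (hp2 : p ≠ 2)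
    (hι : Fintype.card ι = p ^ n) (hα : α ^ p ^ m = 1) (he0 : e 0 = 0)
    (hsum : (p : ℤ) ∣ ∑ i, e i) {s : ι} (hs : ¬ (p : ℤ) ∣ e s) :
    gamma3 (dirGroup α β e) =
      Subgroup.pi Set.univ fun _ => gamma3 (Subgroup.closure {α, β}) := by
  let H := Subgroup.closure {α, β}
  let α' : H := ⟨α, Subgroup.subset_closure (Set.mem_insert _ _)⟩
  let β' : H := ⟨β, Subgroup.subset_closure (Set.mem_insert_of_mem _ rfl)⟩
  have htop : (⊤ : Subgroup H).map H.subtype = H := by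
    rw [← MonoidHom.range_eq_map, Subgroup.range_subtype]
  have hgen : Subgroup.closure {α', β'} = ⊤ := by
    refine Subgroup.map_injective H.subtype_injective ?_
    rw [htop, MonoidHom.map_closure, Set.image_insert_eq, Set.image_singleton]
    rfl
  let f : (ι → H) →* (ι → B) := H.subtype.compLeft ι
  have hdir : (dirGroup α' β' e).map f = dirGroup α β e := by
    rw [dirGroup, MonoidHom.map_closure, ← Set.range_comp]
    congr 2
    funext i k
    show ((dirTuple α' β' e i k : H) : B) = _
    rw [dirTuple, dirTuple]
    split_ifs <;> rfl
  have hmain := gamma3_dirGroup (β := β') hp2 hι hgen (m := m) (Subtype.ext hα) he0 hsum hs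
  rw [← hdir, ← map_gamma3, hmain]
  have hg : (gamma3 (⊤ : Subgroup H)).map H.subtype = gamma3 H := by rw [map_gamma3, htop]
  ext g
  constructor
  · rintro ⟨g', hg', rfl⟩ i _
    rw [← hg]
    exact ⟨g' i, hg' i trivial, rfl⟩
  · intro hg'
    have h : ∀ i, ∃ x ∈ gamma3 (⊤ : Subgroup H), H.subtype x = g i := by
      intro i
      have := hg' i trivial
      rwa [← hg] at this
    choose x hx hxg using h
    exact ⟨x, fun i _ => hx i, funext hxg⟩

/-! ### The first layer stabiliser -/

theorem finRotate_zpow_apply {N : ℕ} [NeZero N] (t : ℤ) (x : Fin N) :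
    (finRotate N ^ t) x = x + t • (1 : Fin N) := by
  have h1 : ∀ y : Fin N, (finRotate N)⁻¹ y = y - 1 := by
    intro y
    rw [Equiv.Perm.inv_eq_iff_eq, finRotate_apply, sub_add_cancel]
  induction t generalizing x with
  | zero => rw [zpow_zero, zero_smul, add_zero, Equiv.Perm.one_apply]
  | succ k ih =>
    rw [zpow_add_one, Equiv.Perm.mul_apply, ih, finRotate_apply, add_smul, one_smul]
    abel
  | pred k ih =>
    rw [zpow_sub_one, Equiv.Perm.mul_apply, ih, h1, sub_smul, one_smul]
    abel

theorem fin_val_add_one {N : ℕ} [NeZero N] (y : Fin N) : (y + 1).val = (y.val + 1) % N := by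
  rw [Fin.val_add, Fin.val_one', Nat.add_mod_mod]

theorem fin_val_nsmul_one {N : ℕ} [NeZero N] (k : ℕ) : (k • (1 : Fin N)).val = k % N := by
  induction k with
  | zero => rw [zero_smul, Nat.zero_mod]; rfl
  | succ k ih => rw [succ_nsmul, fin_val_add_one, ih, Nat.mod_add_mod]

theorem exists_zsmul_one {N : ℕ} [NeZero N] (x : Fin N) : ∃ t : ℤ, t • (1 : Fin N) = x := by
  refine ⟨x.val, Fin.ext ?_⟩
  rw [natCast_zsmul, fin_val_nsmul_one, Nat.mod_eq_of_lt x.isLt]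

theorem finRotate_zpow_eq_one_iff {N : ℕ} [NeZero N] (t : ℤ) :
    finRotate N ^ t = 1 ↔ (N : ℤ) ∣ t := by
  have hord : addOrderOf (1 : Fin N) = N := by
    refine Nat.dvd_antisymm (addOrderOf_dvd_of_nsmul_eq_zero (Fin.ext ?_)) ?_
    · rw [fin_val_nsmul_one, Nat.mod_self]; rfl
    · have h := fin_val_nsmul_one (N := N) (addOrderOf (1 : Fin N))
      rw [addOrderOf_nsmul_eq_zero] at h
      exact Nat.dvd_of_mod_eq_zero h.symm
  have h : finRotate N ^ t = 1 ↔ t • (1 : Fin N) = 0 := by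
    constructor
    · intro h
      rw [← zero_add (t • (1 : Fin N)), ← finRotate_zpow_apply, h, Equiv.Perm.one_apply]
    · intro h
      refine Equiv.ext fun x => ?_
      rw [finRotate_zpow_apply, h, add_zero, Equiv.Perm.one_apply]
  rw [h, ← addOrderOf_dvd_iff_zsmul_eq_zero, hord]

/-- The exponents of the sections of `b_n` as a function on the cyclic group `Fin (d n)`: the value at
`j` belongs to the `j`-th vertex of the first layer, counted from `1`, and the value at `0` (the last
vertex, with section `b_{n+1}`) is set to `0`. -/
def exponents (d : ℕ → ℕ) (e : ℕ → ℤ) (n : ℕ) (j : Fin (d n)) : ℤ :=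
  if j.val = 0 then 0 else if j.val < d 0 then e j.val else 0

/-- The sections of the conjugates of `b_n` form directed tuples: `b_{n+1}` is at the last letter,
which is `-1` in `Fin (d n)`, moved by `t`. -/
theorem sectionAt_conj_genB (e : ℕ → ℤ) {n : ℕ} [NeZero (d n)] (t : ℤ) (x : Fin (d n)) :
    sectionAt (genA d n ^ t * genB d e n * (genA d n ^ t)⁻¹) (.single x) =
      dirTuple (genA d (n + 1)) (genB d e (n + 1)) (exponents d e n) (t • 1 - 1) x := by
  set y : Fin (d n) := x - t • 1 with hy
  have h1 : (genA d n ^ t)⁻¹.1 (n + 1) (.single x) = .single y := by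
    rw [← zpow_neg, genA_zpow, rooted_apply_single, finRotate_zpow_apply, neg_smul,
      ← sub_eq_add_neg]
  have h2 : sectionAt (genA d n ^ t)⁻¹ (.single x) = 1 := by
    rw [← zpow_neg, genA_zpow, sectionAt_rooted_single]
  rw [sectionAt_mul, sectionAt_mul, h2, h1, mul_one, genB_apply_single, genA_zpow,
    sectionAt_rooted_single, one_mul]
  have hxy : x - (t • 1 - 1) = y + 1 := by rw [hy]; abel
  have hval := fin_val_add_one y
  by_cases hlast : y.val + 1 = d n
  · rw [sectionAt_genB_last e hlast, dirTuple, if_pos]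
    rw [hlast, Nat.mod_self] at hval
    rw [← sub_eq_zero, hxy]
    exact Fin.ext hval
  · rw [Nat.mod_eq_of_lt (by omega)] at hval
    rw [sectionAt_genB e hlast, dirTuple_of_ne, hxy, exponents, if_neg (by omega), hval, dirLabel]
    · split_ifs
      · rw [genA_zpow]
      · rw [zpow_zero, rooted_eq_one_iff]
    · intro h
      rw [← sub_eq_zero, hxy] at h
      rw [h] at hval
      exact absurd hval (by simp)

theorem conj_genB_mem_levelStab (e : ℕ → ℤ) {n : ℕ} (t : ℤ) :
    genA d n ^ t * genB d e n * (genA d n ^ t)⁻¹ ∈ levelStab d n (n + 1) := by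
  intro v
  show (genA d n ^ t).1 (n + 1) ((genB d e n).1 (n + 1) ((genA d n ^ t)⁻¹.1 (n + 1) v)) = v
  rw [genB_mem_levelStab e n]
  show ((genA d n ^ t * (genA d n ^ t)⁻¹ : treeAut d n)).1 (n + 1) v = v
  rw [mul_inv_cancel]
  rfl

/-- The stabiliser in `G_n` of the first layer of `T_n` is generated by the conjugates of `b_n` by
the powers of `a_n`. -/
theorem ggs_inf_levelStab (e : ℕ → ℤ) (n : ℕ) :
    ggs d e n ⊓ levelStab d n (n + 1) =
      Subgroup.closure (Set.range fun t : ℤ => genA d n ^ t * genB d e n * (genA d n ^ t)⁻¹) := by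
  set S := Subgroup.closure
    (Set.range fun t : ℤ => genA d n ^ t * genB d e n * (genA d n ^ t)⁻¹) with hS
  have hmem : ∀ t : ℤ, genA d n ^ t * genB d e n * (genA d n ^ t)⁻¹ ∈ S :=
    fun t => Subgroup.subset_closure ⟨t, rfl⟩
  have hSle : S ≤ levelStab d n (n + 1) := by
    rw [hS, Subgroup.closure_le]
    rintro _ ⟨t, rfl⟩
    exact conj_genB_mem_levelStab e t
  refine le_antisymm ?_ (le_inf ?_ hSle)
  · rintro f ⟨hf, hfst⟩
    -- Every element of `G_n` is a power of `a_n` times a product of conjugates of `b_n`.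
    have hdecomp : ∃ (t : ℤ), ∃ w ∈ S, f = genA d n ^ t * w := by
      have hb : ∀ (ε : treeAut d n), (∀ t : ℤ, (genA d n ^ t)⁻¹ * ε * genA d n ^ t ∈ S) →
          ∀ y, (∃ (t : ℤ), ∃ w ∈ S, y = genA d n ^ t * w) →
            ∃ (t : ℤ), ∃ w ∈ S, ε * y = genA d n ^ t * w := by
        rintro ε hε _ ⟨t, w, hw, rfl⟩
        exact ⟨t, _, mul_mem (hε t) hw, by group⟩
      have hconj : ∀ t : ℤ, (genA d n ^ t)⁻¹ * genB d e n * genA d n ^ t ∈ S := by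
        intro t
        have := hmem (-t)
        rwa [zpow_neg, inv_inv] at this
      clear hfst
      induction hf using Subgroup.closure_induction_left with
      | one => exact ⟨0, 1, one_mem _, by simp⟩
      | mul_left x hx y hy ih =>
        rcases hx with rfl | rfl
        · obtain ⟨t, w, hw, rfl⟩ := ih
          exact ⟨1 + t, w, hw, by rw [zpow_one_add, mul_assoc]⟩
        · exact hb _ hconj y ih
      | inv_mul_cancel x hx y _ ih =>
        rcases hx with rfl | rfl
        · obtain ⟨t, w, hw, rfl⟩ := ih
          exact ⟨-1 + t, w, hw, by rw [zpow_add, zpow_neg_one, mul_assoc]⟩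
        · refine hb _ (fun t => ?_) y ih
          have := inv_mem (hconj t)
          rwa [mul_inv_rev, mul_inv_rev, inv_inv, ← mul_assoc] at this
    obtain ⟨t, w, hw, rfl⟩ := hdecomp
    have ht : genA d n ^ t ∈ levelStab d n (n + 1) := by
      have := Subgroup.mul_mem _ hfst (Subgroup.inv_mem _ (hSle hw))
      rwa [mul_inv_cancel_right] at this
    have ht1 : genA d n ^ t = 1 := by
      rw [genA_zpow, rooted_eq_one_iff]
      refine Equiv.ext fun x => Vertex.single_injective ?_
      have := ht (.single x)
      rwa [genA_zpow, rooted_apply_single] at this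
    rwa [ht1, one_mul]
  · rw [hS, Subgroup.closure_le]
    rintro _ ⟨t, rfl⟩
    exact mul_mem (mul_mem (zpow_mem (genA_mem e n) t) (genB_mem e n))
      (inv_mem (zpow_mem (genA_mem e n) t))

theorem psiImage_map_subtype {n k : ℕ} (H : Subgroup (levelStab d n k)) :
    psiImage (H.map (levelStab d n k).subtype) k = H.map (psi d n k) := by
  rw [psiImage, Subgroup.subgroupOf, Subgroup.comap_map_eq_self_of_injective]
  exact Subtype.val_injective

theorem psiImage_gamma3 {n k : ℕ} {H : Subgroup (treeAut d n)} (hH : H ≤ levelStab d n k) :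
    psiImage (gamma3 H) k = gamma3 (psiImage H k) := by
  have h : (H.subgroupOf (levelStab d n k)).map (levelStab d n k).subtype = H := by
    rw [Subgroup.subgroupOf_map_subtype, inf_eq_left.2 hH]
  rw [← h, ← map_gamma3, psiImage_map_subtype, psiImage_map_subtype, map_gamma3]

/-- Tuples indexed by the letters, read as tuples indexed by the first layer. -/
noncomputable def tupleHom (d : ℕ → ℕ) (n : ℕ) :
    (Fin (d n) → treeAut d (n + 1)) →* (Vertex d n (n + 1) → treeAut d (n + 1)) where
  toFun g v := g ((Vertex.singleEquiv d n).symm v)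
  map_one' := rfl
  map_mul' _ _ := rfl

theorem tupleHom_apply_single {n : ℕ} (g : Fin (d n) → treeAut d (n + 1)) (x : Fin (d n)) :
    tupleHom d n g (.single x) = g x := by
  show g ((Vertex.singleEquiv d n).symm (Vertex.singleEquiv d n x)) = g x
  rw [Equiv.symm_apply_apply]

/-- `ψ₁` maps the first layer stabiliser of `G_n` onto the directed group. -/
theorem psiImage_ggs_inf_levelStab (e : ℕ → ℤ) {n : ℕ} [NeZero (d n)] :
    psiImage (ggs d e n ⊓ levelStab d n (n + 1)) (n + 1) =
      (dirGroup (genA d (n + 1)) (genB d e (n + 1)) (exponents d e n)).map (tupleHom d n) := by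
  let c : ℤ → levelStab d n (n + 1) := fun t =>
    ⟨genA d n ^ t * genB d e n * (genA d n ^ t)⁻¹, conj_genB_mem_levelStab e t⟩
  have hc : ggs d e n ⊓ levelStab d n (n + 1) =
      (Subgroup.closure (Set.range c)).map (levelStab d n (n + 1)).subtype := by
    rw [ggs_inf_levelStab, MonoidHom.map_closure, ← Set.range_comp]
    rfl
  rw [hc, psiImage_map_subtype, dirGroup, MonoidHom.map_closure, MonoidHom.map_closure,
    ← Set.range_comp, ← Set.range_comp]
  have hval : ∀ t : ℤ, psi d n (n + 1) (c t) = tupleHom d n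
      (dirTuple (genA d (n + 1)) (genB d e (n + 1)) (exponents d e n) (t • 1 - 1)) := by
    intro t
    funext v
    obtain ⟨x, rfl⟩ := Vertex.single_surjective v
    rw [tupleHom_apply_single]
    exact sectionAt_conj_genB e t x
  congr 1
  ext g
  constructor
  · rintro ⟨t, rfl⟩
    exact ⟨_, (hval t).symm⟩
  · rintro ⟨i, rfl⟩
    obtain ⟨t, ht⟩ := exists_zsmul_one (i + 1)
    refine ⟨t, ?_⟩
    show psi d n (n + 1) (c t) = _
    rw [hval, ht, add_sub_cancel_right]
    rfl

theorem map_tupleHom_pi {n : ℕ} (K : Subgroup (treeAut d (n + 1))) :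
    (Subgroup.pi Set.univ fun _ => K).map (tupleHom d n) = levelProd n K := by
  ext g
  rw [mem_levelProd]
  constructor
  · rintro ⟨g', hg', rfl⟩ v
    exact hg' _ trivial
  · intro hg
    refine ⟨fun x => g (.single x), fun x _ => hg _, funext fun v => ?_⟩
    obtain ⟨x, rfl⟩ := Vertex.single_surjective v
    rw [tupleHom_apply_single]

/-! ### Finite nilpotent quotients -/

/-- A nilpotent group of class at most two generated by two elements of finite order is finite. -/
theorem finite_of_gamma3_eq_bot {Q : Type*} [Group Q] {a b : Q}
    (hgen : Subgroup.closure {a, b} = ⊤) (h3 : gamma3 (⊤ : Subgroup Q) = ⊥)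
    (ha : IsOfFinOrder a) (hb : IsOfFinOrder b) : Finite Q := by
  have hcentral : ∀ x ∈ commutator Q, ∀ h, Commute x h := by
    intro x hx h
    have := commutator_mem_gamma3_top hx h
    rw [h3, Subgroup.mem_bot] at this
    exact commutatorElement_eq_one_iff_commute.1 this
  set c : Q := ⁅a, b⁆ with hc
  have hcc : ∀ h, Commute c h := hcentral c (commutator_mem_commutator_top a b)
  have hnormal : (Subgroup.zpowers c).Normal := by
    refine ⟨?_⟩
    rintro _ ⟨t, rfl⟩ h
    refine ⟨t, ?_⟩
    show c ^ t = h * c ^ t * h⁻¹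
    rw [← ((hcc h).zpow_left t).eq, mul_inv_cancel_right]
  -- The derived subgroup is generated by the central element `c` of finite order, and the quotient
  -- by it is abelian and generated by two elements of finite order.
  have hle : commutator Q ≤ Subgroup.zpowers c :=
    commutator_le_of_generators hgen _ (Subgroup.mem_zpowers c)
  have hpow : ∀ k : ℕ, ⁅a ^ k, b⁆ = c ^ k := by
    intro k
    induction k with
    | zero => rw [pow_zero, pow_zero, commutatorElement_one_left]
    | succ k ih =>
      rw [pow_succ, commutatorElement_mul_left_eq_conj_mul, ih, ← hc, ← (hcc (a ^ k)).eq,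
        mul_inv_cancel_right, pow_succ']
  have hcfin : IsOfFinOrder c := by
    obtain ⟨k, hk, hk1⟩ := isOfFinOrder_iff_pow_eq_one.1 ha
    exact isOfFinOrder_iff_pow_eq_one.2 ⟨k, hk, by rw [← hpow, hk1, commutatorElement_one_left]⟩
  have hfin : Finite (Subgroup.zpowers c) := finite_zpowers.2 hcfin
  have hcomm : IsMulCommutative (Q ⧸ Subgroup.zpowers c) :=
    Subgroup.Normal.quotient_commutative_iff_commutator_le.2 hle
  let _ : CommGroup (Q ⧸ Subgroup.zpowers c) :=
    { (inferInstance : Group (Q ⧸ Subgroup.zpowers c)) with mul_comm := hcomm.is_comm.comm }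
  let π : Q →* Q ⧸ Subgroup.zpowers c := QuotientGroup.mk' _
  have hafin : Finite (Subgroup.zpowers (π a)) := finite_zpowers.2 (π.isOfFinOrder ha)
  have hbfin : Finite (Subgroup.zpowers (π b)) := finite_zpowers.2 (π.isOfFinOrder hb)
  have hquot : Finite (Q ⧸ Subgroup.zpowers c) := by
    refine Finite.of_surjective
      (fun x : Subgroup.zpowers (π a) × Subgroup.zpowers (π b) => x.1.1 * x.2.1) ?_
    intro y
    obtain ⟨y, rfl⟩ := QuotientGroup.mk'_surjective _ y
    have hy : π y ∈ Subgroup.closure {π a, π b} := by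
      rw [← Set.image_pair, ← MonoidHom.map_closure, hgen]
      exact ⟨y, Subgroup.mem_top y, rfl⟩
    obtain ⟨i, j, hij⟩ := Subgroup.mem_closure_pair.1 hy
    exact ⟨(⟨_, i, rfl⟩, ⟨_, j, rfl⟩), hij⟩
  exact Finite.of_subgroup_quotient (Subgroup.zpowers c)

/-- In a group generated by `a` and `b`, with `a` of finite order, the normal closure of a
power of `b` with positive exponent and the third term of the lower central series span a subgroup
of finite index. -/
theorem relIndex_normalClosureIn_sup_gamma3_ne_zero {B : Type*} [Group B] {a b : B}
    (ha : IsOfFinOrder a) {N : ℕ} (hN : 0 < N) :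
    (normalClosureIn (Subgroup.closure {a, b}) (b ^ N) ⊔
      gamma3 (Subgroup.closure {a, b})).relIndex (Subgroup.closure {a, b}) ≠ 0 := by
  set H := Subgroup.closure {a, b} with hH
  let a' : H := ⟨a, Subgroup.subset_closure (Set.mem_insert _ _)⟩
  let b' : H := ⟨b, Subgroup.subset_closure (Set.mem_insert_of_mem _ rfl)⟩
  have htop : (⊤ : Subgroup H).map H.subtype = H := by
    rw [← MonoidHom.range_eq_map, Subgroup.range_subtype]
  have hgen : Subgroup.closure {a', b'} = ⊤ := by
    refine Subgroup.map_injective H.subtype_injective ?_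
    rw [htop, MonoidHom.map_closure, Set.image_insert_eq, Set.image_singleton]
    rfl
  let K : Subgroup H := Subgroup.normalClosure {b' ^ N} ⊔ gamma3 ⊤
  have hK : K ≤ (normalClosureIn H (b ^ N) ⊔ gamma3 H).subgroupOf H := by
    refine sup_le ?_ ?_
    · rw [Subgroup.normalClosure, Subgroup.closure_le]
      intro y hy
      obtain ⟨z, rfl, hz⟩ := Group.mem_conjugatesOfSet_iff.1 hy
      obtain ⟨h, rfl⟩ := isConj_iff.1 hz
      exact Subgroup.mem_sup_left (Subgroup.subset_closure ⟨h, h.2, rfl⟩)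
    · intro y hy
      refine Subgroup.mem_sup_right ?_
      have h := map_gamma3 H.subtype ⊤
      rw [htop] at h
      rw [← h]
      exact ⟨y, hy, rfl⟩
  let π : H →* H ⧸ K := QuotientGroup.mk' K
  have hsurj : Function.Surjective π := QuotientGroup.mk'_surjective K
  have hfin : Finite (H ⧸ K) := by
    refine finite_of_gamma3_eq_bot (a := π a') (b := π b') ?_ ?_ (π.isOfFinOrder ?_) ?_
    · rw [← Set.image_pair, ← MonoidHom.map_closure, hgen, Subgroup.map_top_of_surjective _ hsurj]
    · rw [← Subgroup.map_top_of_surjective π hsurj, ← map_gamma3, Subgroup.map_eq_bot_iff,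
        QuotientGroup.ker_mk']
      exact le_sup_right
    · exact (Submonoid.isOfFinOrder_coe (H := H.toSubmonoid) (x := a')).1 ha
    · refine isOfFinOrder_iff_pow_eq_one.2 ⟨N, hN, ?_⟩
      rw [← map_pow]
      exact (QuotientGroup.eq_one_iff _).2
        (Subgroup.mem_sup_left (Subgroup.subset_normalClosure rfl))
  have hindex : K.index ≠ 0 := Subgroup.index_ne_zero_of_finite
  exact fun h => hindex (Nat.eq_zero_of_zero_dvd (h ▸ Subgroup.index_dvd_of_le hK))

/-! ### Rigid stabilisers -/

theorem sectionAt_pow {n k : ℕ} {f : treeAut d n} {u : Vertex d n k} (h : f.1 k u = u) (N : ℕ) :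
    sectionAt (f ^ N) u = sectionAt f u ^ N := by
  induction N with
  | zero => rw [pow_zero, pow_zero, sectionAt_one]
  | succ N ih => rw [pow_succ, sectionAt_mul, h, ih, pow_succ]

theorem genA_zpow_eq_one_iff {n : ℕ} [NeZero (d n)] (t : ℤ) :
    genA d n ^ t = 1 ↔ (d n : ℤ) ∣ t := by
  rw [genA_zpow, rooted_eq_one_iff, finRotate_zpow_eq_one_iff]

/-- A power of `b_0` whose exponent is divisible by the orders of `a_1, …, a_n` has exactly one
non-trivial section at level `n`, which is a power of `b_n`. -/
theorem exists_sectionAt_genB_pow (hd : ∀ i, 0 < d i) (e : ℕ → ℤ) {N : ℕ} (n : ℕ)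
    (hN : ∀ i, i ≤ n → d i ∣ N) :
    genB d e 0 ^ N ∈ levelStab d 0 n ∧ ∃ u : Vertex d 0 n, ∀ v : Vertex d 0 n,
      (v = u → sectionAt (genB d e 0 ^ N) v = genB d e n ^ N) ∧
      (v ≠ u → sectionAt (genB d e 0 ^ N) v = 1) := by
  induction n with
  | zero =>
    refine ⟨fun v => ?_, .nil 0, fun v => ⟨?_, ?_⟩⟩
    · rw [Vertex.eq_nil v]
      exact Vertex.eq_nil _
    · rintro rfl
      exact sectionAt_nil _
    · exact fun h => absurd v.eq_nil h
  | succ n ih =>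
    obtain ⟨hst, u, hu⟩ := ih fun i hi => hN i (hi.trans (Nat.le_succ n))
    have hone : ∀ x : Fin (d n), sectionAt (genB d e n ^ N) (.single x) =
        if x.val + 1 = d n then genB d e (n + 1) ^ N else 1 := by
      intro x
      rw [sectionAt_pow (genB_apply_single e x)]
      split_ifs with hx
      · rw [sectionAt_genB_last e hx]
      · have : NeZero (d (n + 1)) := ⟨(hd (n + 1)).ne'⟩
        rw [sectionAt_genB e hx, ← rootedHom_apply, ← map_pow, rootedHom_apply, rooted_eq_one_iff,
          dirLabel]
        split_ifs
        · rw [← zpow_natCast, zpow_comm, zpow_natCast, ← zpow_natCast,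
            (finRotate_zpow_eq_one_iff _).2 (Int.natCast_dvd_natCast.2 (hN _ le_rfl)), one_zpow]
        · exact one_pow N
    refine ⟨mem_levelStab_of_sectionAt (Nat.zero_le n) (Nat.le_succ n) hst fun v => ?_,
      u.append (.single ⟨d n - 1, Nat.sub_lt (hd n) one_pos⟩), fun w => ?_⟩
    · by_cases h : v = u
      · rw [(hu v).1 h]
        exact pow_mem (genB_mem_levelStab e n) N
      · rw [(hu v).2 h]
        exact one_mem _
    · obtain ⟨v, t, rfl⟩ := w.exists_append (Nat.zero_le n) (Nat.le_succ n)
      obtain ⟨x, rfl⟩ := Vertex.single_surjective t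
      rw [sectionAt_append]
      have hx : x.val + 1 = d n ↔ x = ⟨d n - 1, Nat.sub_lt (hd n) one_pos⟩ := by
        rw [Fin.ext_iff]
        have := hd n
        show _ ↔ x.val = d n - 1
        omega
      constructor
      · intro h
        obtain ⟨h1, h2⟩ := Vertex.append_inj h
        rw [(hu v).1 h1, hone, if_pos (hx.2 (Vertex.single_injective h2))]
      · intro h
        by_cases hv : v = u
        · rw [(hu v).1 hv, hone, if_neg]
          intro hx'
          exact h (by rw [hv, hx.1 hx'])
        · rw [(hu v).2 hv, sectionAt_one]

theorem sectionAt_conj {n k : ℕ} {f : treeAut d n} (hf : f ∈ levelStab d n k) (g : treeAut d n)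
    (v : Vertex d n k) :
    sectionAt (g * f * g⁻¹) v =
      sectionAt g (g⁻¹.1 k v) * sectionAt f (g⁻¹.1 k v) * (sectionAt g (g⁻¹.1 k v))⁻¹ := by
  rw [sectionAt_mul, sectionAt_mul, sectionAt_inv, hf]

theorem conj_mem_levelStab {n k : ℕ} {f : treeAut d n} (hf : f ∈ levelStab d n k)
    (g : treeAut d n) : g * f * g⁻¹ ∈ levelStab d n k := by
  intro v
  show g.1 k (f.1 k (g⁻¹.1 k v)) = v
  rw [hf]
  show (g * g⁻¹).1 k v = v
  rw [mul_inv_cancel]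
  rfl

open Classical in
/-- An element of `G` in the stabiliser of level `k` with a single non-trivial section contributes
to the image of the rigid level stabiliser. -/
theorem mulSingle_mem_psiImage {n k : ℕ} (hd : ∀ i, 0 < d i) (hk : n ≤ k)
    {G : Subgroup (treeAut d n)} {f : treeAut d n} (hfG : f ∈ G) (hf : f ∈ levelStab d n k)
    {u : Vertex d n k} {x : treeAut d k} (hu : sectionAt f u = x)
    (h : ∀ v, v ≠ u → sectionAt f v = 1) :
    (Pi.mulSingle u x : Vertex d n k → treeAut d k) ∈ psiImage (rigidLevelStab G k) k := by
  refine mem_psiImage.2 ⟨f, le_iSup (rigidStab G) u (mem_rigidStab hd hk hfG hf h), hf, ?_⟩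
  intro v
  rcases eq_or_ne v u with rfl | hv
  · rw [Pi.mulSingle_eq_same, hu]
  · rw [Pi.mulSingle_eq_of_ne hv, h v hv]

/-- Inclusions between consecutive levels compose. -/
theorem levelProd_le_psiImage {F : ∀ n, Subgroup (treeAut d n)}
    (hF : ∀ n, levelProd n (F (n + 1)) ≤ psiImage (F n) (n + 1)) (n : ℕ) :
    levelProd 0 (F n) ≤ psiImage (F 0) n := by
  induction n with
  | zero =>
    intro g hg
    refine mem_psiImage.2 ⟨g (.nil 0), mem_levelProd.1 hg _, fun v => ?_, fun v => ?_⟩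
    · rw [v.eq_nil]
      exact Vertex.eq_nil _
    · rw [v.eq_nil, sectionAt_nil]
  | succ n ih =>
    intro g hg
    have h1 : ∀ u : Vertex d 0 n, ∃ f ∈ F n, f ∈ levelStab d n (n + 1) ∧
        ∀ v, sectionAt f v = g (u.append v) := by
      intro u
      exact mem_psiImage.1 (hF n (mem_levelProd.2 fun v => mem_levelProd.1 hg (u.append v)))
    choose f hfF hfst hfsec using h1
    obtain ⟨f₀, hf₀F, hf₀st, hf₀⟩ := mem_psiImage.1 (ih (mem_levelProd.2 hfF))
    refine mem_psiImage.2 ⟨f₀, hf₀F, mem_levelStab_of_sectionAt (Nat.zero_le n) (Nat.le_succ n)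
      hf₀st fun u => ?_, fun w => ?_⟩
    · rw [hf₀]
      exact hfst u
    · obtain ⟨u, v, rfl⟩ := w.exists_append (Nat.zero_le n) (Nat.le_succ n)
      rw [sectionAt_append, hf₀, hfsec]

/-- The action on the `k`-th level, as a homomorphism. -/
def levelHom (d : ℕ → ℕ) (n k : ℕ) : treeAut d n →* Equiv.Perm (Vertex d n k) where
  toFun f := f.1 k
  map_one' := rfl
  map_mul' _ _ := rfl

theorem ker_levelHom (n k : ℕ) : (levelHom d n k).ker = levelStab d n k := by
  ext f
  rw [MonoidHom.mem_ker, mem_levelStab]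
  exact Equiv.ext_iff

/-- If the image under `ψ` of the rigid stabiliser of level `k` contains a direct product of
copies of a subgroup `K` of finite index in a group containing all sections, then the rigid level
stabiliser has finite index. -/
theorem finiteIndex_rigidLevelStab {n k : ℕ} (hd : ∀ i, 0 < d i) (hk : n ≤ k)
    {G : Subgroup (treeAut d n)} {H K : Subgroup (treeAut d k)} (hGH : G ≤ sectionsIn n H)
    (hKH : K.relIndex H ≠ 0) (hK : levelProd n K ≤ psiImage (rigidLevelStab G k) k) :
    ((rigidLevelStab G k).subgroupOf G).FiniteIndex := by
  have hst : (levelStab d n k).relIndex G ≠ 0 := by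
    rw [← ker_levelHom]
    have hfin : (levelHom d n k).ker.index ≠ 0 := Subgroup.index_ne_zero_of_finite
    exact fun h => hfin (Nat.eq_zero_of_zero_dvd (h ▸ Subgroup.relIndex_dvd_index_of_normal _ _))
  let σ : Vertex d n k → levelStab d n k →* treeAut d k := fun u =>
    (Pi.evalMonoidHom (fun _ => treeAut d k) u).comp (psi d n k)
  have hσ : ∀ u, (K.comap (σ u)).relIndex (G.subgroupOf (levelStab d n k)) ≠ 0 := by
    intro u
    rw [Subgroup.relIndex_comap]
    refine fun h => hKH (Subgroup.relIndex_eq_zero_of_le_right ?_ h)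
    rintro _ ⟨f, hf, rfl⟩
    exact hGH hf u
  have hinf : ⨅ u, K.comap (σ u) ≤ (rigidLevelStab G k).subgroupOf (levelStab d n k) := by
    intro f hf
    rw [Subgroup.mem_iInf] at hf
    obtain ⟨f', hf', hf'st, hsec⟩ := mem_psiImage.1
      (hK (mem_levelProd.2 hf : (fun u => sectionAt f.1 u) ∈ levelProd n K))
    have : f' = f.1 := eq_of_sectionAt_eq hd hk hf'st f.2 hsec
    show f.1 ∈ rigidLevelStab G k
    rwa [← this]
  have hrel : (rigidLevelStab G k).relIndex (G ⊓ levelStab d n k) ≠ 0 := by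
    rw [← Subgroup.relIndex_subgroupOf (L := levelStab d n k) inf_le_right,
      Subgroup.inf_subgroupOf_right]
    exact fun h => Subgroup.relIndex_iInf_ne_zero hσ (Subgroup.relIndex_eq_zero_of_le_left hinf h)
  refine ⟨?_⟩
  refine Subgroup.relIndex_ne_zero_trans hrel ?_
  rwa [Subgroup.inf_relIndex_left]

/-! ### Growing GGS-groups -/

variable {p : ℕ} {m : ℕ → ℕ} {e : ℕ → ℤ}

namespace IsDefiningData

theorem mono (h : IsDefiningData p m e) {i j : ℕ} (hi : 1 ≤ i) (hij : i ≤ j) : m i ≤ m j := by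
  induction j, hij using Nat.le_induction with
  | base => exact le_rfl
  | succ j hj ih => exact ih.trans (h.increasing j (hi.trans hj)).le

theorem pTree_pos (h : IsDefiningData p m e) (n : ℕ) : 0 < pTree p m n := pow_pos h.prime.pos _

theorem pTree_dvd (h : IsDefiningData p m e) {i j : ℕ} (hij : i ≤ j) :
    pTree p m i ∣ pTree p m j :=
  pow_dvd_pow p (h.mono (Nat.le_add_left 1 i) (Nat.add_le_add_right hij 1))

theorem pTree_zero_le (h : IsDefiningData p m e) (n : ℕ) : pTree p m 0 ≤ pTree p m n :=
  Nat.le_of_dvd (h.pTree_pos n) (h.pTree_dvd (Nat.zero_le n))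

theorem genA_pow_eq_one (h : IsDefiningData p m e) (n : ℕ) :
    genA (pTree p m) n ^ p ^ m (n + 1) = 1 := by
  have : NeZero (pTree p m n) := ⟨(h.pTree_pos n).ne'⟩
  rw [← zpow_natCast, genA_zpow_eq_one_iff]
  exact dvd_rfl

theorem card_fin_pTree (n : ℕ) : Fintype.card (Fin (pTree p m n)) = p ^ m (n + 1) :=
  Fintype.card_fin _

theorem exponents_zero {d : ℕ → ℕ} {n : ℕ} [NeZero (d n)] : exponents d e n 0 = 0 :=
  if_pos rfl

theorem exists_exponents_not_dvd (h : IsDefiningData p m e) (he : NonzeroModP p m e) (n : ℕ) :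
    ∃ s, ¬ (p : ℤ) ∣ exponents (pTree p m) e n s := by
  obtain ⟨j, hj1, hj2, hj⟩ := he
  have hlt : j < pTree p m 0 := by
    have := h.pTree_pos 0
    show j < p ^ m 1
    have : 0 < p ^ m 1 := this
    omega
  refine ⟨⟨j, hlt.trans_le (h.pTree_zero_le n)⟩, ?_⟩
  rw [exponents, if_neg (by show j ≠ 0; omega), if_pos hlt]
  rwa [Int.modEq_zero_iff_dvd] at hj

theorem sum_exponents (h : IsDefiningData p m e) (n : ℕ) :
    ∑ j, exponents (pTree p m) e n j = ∑ j ∈ Finset.Icc 1 (p ^ m 1 - 1), e j := by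
  have h0 : 0 < p ^ m 1 := h.pTree_pos 0
  have h1 : p ^ m 1 ≤ pTree p m n := h.pTree_zero_le n
  have h2 := Fin.sum_univ_eq_sum_range
    (fun j => if j = 0 then 0 else if j < pTree p m 0 then e j else 0) (pTree p m n)
  refine h2.trans (Eq.symm ?_)
  have h3 : ∀ j ∈ Finset.Icc 1 (p ^ m 1 - 1), e j =
      if j = 0 then 0 else if j < pTree p m 0 then e j else 0 := by
    intro j hj
    rw [Finset.mem_Icc] at hj
    rw [if_neg (by omega), if_pos]
    show j < p ^ m 1
    omega
  rw [Finset.sum_congr rfl h3]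
  refine Finset.sum_subset (fun j hj => ?_) (fun j _ hj => ?_)
  · rw [Finset.mem_Icc] at hj
    rw [Finset.mem_range]
    omega
  · rw [Finset.mem_Icc] at hj
    split_ifs with hj0 hj1
    · rfl
    · have : j < p ^ m 1 := hj1
      omega
    · rfl

/-- If the defining vector is non-zero modulo `p`, then `G_n` moves any vertex of the first layer to
any other, with an arbitrary element of `G_{n+1}` as section. -/
theorem exists_mem_apply_single (h : IsDefiningData p m e) (he : NonzeroModP p m e) (n : ℕ)
    (x y : Fin (pTree p m n)) {g : treeAut (pTree p m) (n + 1)}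
    (hg : g ∈ growingGGS p m e (n + 1)) :
    ∃ f ∈ growingGGS p m e n, f.1 (n + 1) (.single x) = .single y ∧
      sectionAt f (.single x) = g := by
  have : NeZero (pTree p m n) := ⟨(h.pTree_pos n).ne'⟩
  obtain ⟨s, hs⟩ := h.exists_exponents_not_dvd he n
  obtain ⟨g', hg', rfl⟩ := exists_mem_dirGroup_apply_eq_of_mem_closure
    h.prime (h.genA_pow_eq_one (n + 1)) exponents_zero hs x hg
  have hmem : tupleHom _ n g' ∈
      psiImage (growingGGS p m e n ⊓ levelStab (pTree p m) n (n + 1)) (n + 1) := by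
    rw [growingGGS, psiImage_ggs_inf_levelStab]
    exact ⟨g', hg', rfl⟩
  obtain ⟨f, hf, hfst, hsec⟩ := mem_psiImage.1 hmem
  obtain ⟨t, ht⟩ := exists_zsmul_one (y - x)
  refine ⟨genA _ n ^ t * f, mul_mem (zpow_mem (genA_mem e n) t) hf.1, ?_, ?_⟩
  · show (genA (pTree p m) n ^ t).1 (n + 1) (f.1 (n + 1) (.single x)) = _
    rw [hfst, genA_zpow, rooted_apply_single, finRotate_zpow_apply, ht, add_sub_cancel]
  · rw [sectionAt_mul, hfst, genA_zpow, sectionAt_rooted_single, one_mul, hsec,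
      tupleHom_apply_single]

theorem exists_mem_apply (h : IsDefiningData p m e) (he : NonzeroModP p m e) (n : ℕ) :
    ∀ (u v : Vertex (pTree p m) 0 n), ∀ g ∈ growingGGS p m e n,
      ∃ f ∈ growingGGS p m e 0, f.1 n u = v ∧ sectionAt f u = g := by
  induction n with
  | zero =>
    intro u v g hg
    rw [u.eq_nil, v.eq_nil]
    exact ⟨g, hg, Vertex.eq_nil _, sectionAt_nil g⟩
  | succ n ih =>
    intro u v g hg
    obtain ⟨u, x, rfl⟩ := u.exists_append (Nat.zero_le n) (Nat.le_succ n)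
    obtain ⟨v, y, rfl⟩ := v.exists_append (Nat.zero_le n) (Nat.le_succ n)
    obtain ⟨x, rfl⟩ := Vertex.single_surjective x
    obtain ⟨y, rfl⟩ := Vertex.single_surjective y
    obtain ⟨f', hf', hf'x, hf's⟩ := h.exists_mem_apply_single he n x y hg
    obtain ⟨f, hf, hfu, hfs⟩ := ih u v f' hf'
    refine ⟨f, hf, ?_, ?_⟩
    · rw [sectionAt_spec, hfu, hfs, hf'x]
    · rw [sectionAt_append, hfs, hf's]

theorem sphericallyTransitive (h : IsDefiningData p m e) (he : NonzeroModP p m e) :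
    SphericallyTransitive (growingGGS p m e 0) := by
  intro k u v
  obtain ⟨f, hf, hfu, -⟩ := h.exists_mem_apply he k u v 1 (one_mem _)
  exact ⟨f, hf, hfu⟩

/-- Branching over subgroups `F n` of `G_n` can be extended by the conjugates of a power of `b_n`
of sufficiently large exponent. -/
theorem levelProd_normalClosureIn_sup_le (h : IsDefiningData p m e) (he : NonzeroModP p m e)
    {F : ∀ n, Subgroup (treeAut (pTree p m) n)} (hF0 : F 0 ≤ growingGGS p m e 0)
    (hF : ∀ n, levelProd n (F (n + 1)) ≤ psiImage (F n) (n + 1)) (n : ℕ) :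
    levelProd 0 (normalClosureIn (growingGGS p m e n) (genB (pTree p m) e n ^ p ^ m (n + 1)) ⊔
      F n) ≤ psiImage (rigidLevelStab (growingGGS p m e 0) n) n := by
  classical
  rw [levelProd, Subgroup.pi_le_iff]
  intro u
  rw [Subgroup.map_le_iff_le_comap]
  refine sup_le ?_ ?_
  · rw [normalClosureIn, Subgroup.closure_le]
    rintro _ ⟨g, hg, rfl⟩
    obtain ⟨hst, u₀, hu₀⟩ := exists_sectionAt_genB_pow (d := pTree p m) h.pTree_pos e
      (N := p ^ m (n + 1)) n fun i hi => h.pTree_dvd hi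
    obtain ⟨f, hf, hfu, hfs⟩ := h.exists_mem_apply he n u₀ u g hg
    have hinv : f⁻¹.1 n u = u₀ := by
      rw [← hfu]
      show (f⁻¹ * f).1 n u₀ = u₀
      rw [inv_mul_cancel]
      rfl
    refine mulSingle_mem_psiImage h.pTree_pos (Nat.zero_le n)
      (f := f * genB (pTree p m) e 0 ^ p ^ m (n + 1) * f⁻¹)
      (mul_mem (mul_mem hf (pow_mem (genB_mem e 0) _)) (inv_mem hf))
      (conj_mem_levelStab hst f) ?_ ?_
    · rw [sectionAt_conj hst, hinv, hfs, (hu₀ u₀).1 rfl]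
    · intro v hv
      have hne : f⁻¹.1 n v ≠ u₀ := by
        rw [← hinv]
        exact fun h => hv ((f⁻¹.1 n).injective h)
      rw [sectionAt_conj hst, (hu₀ _).2 hne, mul_one, mul_inv_cancel]
  · intro x hx
    have hmem : (Pi.mulSingle u x : Vertex (pTree p m) 0 n → treeAut (pTree p m) n) ∈
        levelProd 0 (F n) := by
      refine mem_levelProd.2 fun v => ?_
      rw [Pi.mulSingle_apply]
      split_ifs with hv
      · exact hx
      · exact one_mem _
    obtain ⟨f, hf, hfst, hsec⟩ := mem_psiImage.1 (levelProd_le_psiImage hF n hmem)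
    refine mulSingle_mem_psiImage h.pTree_pos (Nat.zero_le n) (hF0 hf) hfst ?_ ?_
    · rw [hsec, Pi.mulSingle_eq_same]
    · intro v hv
      rw [hsec, Pi.mulSingle_eq_of_ne hv]

theorem isBranch (h : IsDefiningData p m e) (he : NonzeroModP p m e)
    (hF : ∀ n, levelProd n (gamma3 (growingGGS p m e (n + 1))) ≤
      psiImage (gamma3 (growingGGS p m e n)) (n + 1)) :
    IsBranch (growingGGS p m e 0) := by
  refine ⟨h.sphericallyTransitive he, fun n hn => ?_⟩
  refine finiteIndex_rigidLevelStab h.pTree_pos hn (ggs_le_sectionsIn e hn) ?_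
    (h.levelProd_normalClosureIn_sup_le he (F := fun n => gamma3 (growingGGS p m e n))
      (gamma3_le_self _) hF n)
  exact relIndex_normalClosureIn_sup_gamma3_ne_zero
    (isOfFinOrder_iff_pow_eq_one.2 ⟨_, h.pTree_pos n, h.genA_pow_eq_one n⟩) (h.pTree_pos n)

/-- The torsion-type condition gives branching over `γ₃` of the first layer stabiliser. -/
theorem psiImage_gamma3_levelStab (h : IsDefiningData p m e) (he : NonzeroModP p m e)
    (ht : TorsionType p m e) (n : ℕ) :
    psiImage (gamma3 (growingGGS p m e n ⊓ levelStab (pTree p m) n (n + 1))) (n + 1) =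
      levelProd n (gamma3 (growingGGS p m e (n + 1))) := by
  have : NeZero (pTree p m n) := ⟨(h.pTree_pos n).ne'⟩
  have : Fact p.Prime := ⟨h.prime⟩
  obtain ⟨s, hs⟩ := h.exists_exponents_not_dvd he n
  have hsum : (p : ℤ) ∣ ∑ j, exponents (pTree p m) e n j := by
    have h0 := ht 0 h.pos
    simp only [Nat.sub_zero, pow_zero, mul_one, zero_add, pow_one] at h0
    rw [h.sum_exponents]
    exact Int.modEq_zero_iff_dvd.1 h0
  rw [psiImage_gamma3 inf_le_right, growingGGS, psiImage_ggs_inf_levelStab, ← map_gamma3,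
    gamma3_dirGroup_closure h.odd (card_fin_pTree n) (h.genA_pow_eq_one (n + 1)) exponents_zero
      hsum hs]
  exact map_tupleHom_pi _

end IsDefiningData

/-! ### Defining vectors divisible by `p` -/

/-- The automorphisms of `T_n` which preserve the residue modulo `p` of the letters of the first
layer, and whose sections at the letters `x` with `x ≢ -1` modulo `p` are rooted. -/
def residueSubgroup (d : ℕ → ℕ) (p n : ℕ) : Subgroup (treeAut d n) where
  carrier := {f | ∀ x : Fin (d n), ∃ y : Fin (d n), f.1 (n + 1) (.single x) = .single y ∧
    y.val ≡ x.val [MOD p] ∧ (¬ p ∣ x.val + 1 → sectionAt f (.single x) ∈ (rootedHom d (n + 1)).range)}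
  one_mem' := fun x => ⟨x, rfl, rfl, fun _ => by rw [sectionAt_one]; exact one_mem _⟩
  mul_mem' := by
    intro f g hf hg x
    obtain ⟨y, hy, hxy, hgs⟩ := hg x
    obtain ⟨z, hz, hyz, hfs⟩ := hf y
    refine ⟨z, ?_, hyz.trans hxy, fun hx => ?_⟩
    · rw [← hz, ← hy]
      rfl
    · rw [sectionAt_mul, hy]
      refine mul_mem (hfs fun h => hx ?_) (hgs hx)
      exact ((hxy.add_right 1).dvd_iff dvd_rfl).1 h
  inv_mem' := by
    intro f hf x
    obtain ⟨w, hw⟩ := Vertex.single_surjective (f⁻¹.1 (n + 1) (.single x))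
    obtain ⟨y, hy, hwy, hfs⟩ := hf w
    have hx : f.1 (n + 1) (.single w) = .single x := by
      rw [hw]
      show (f * f⁻¹).1 (n + 1) (.single x) = _
      rw [mul_inv_cancel]
      rfl
    obtain rfl : x = y := Vertex.single_injective (hx.symm.trans hy)
    refine ⟨w, hw.symm, hwy.symm, fun hx' => ?_⟩
    rw [sectionAt_inv, ← hw]
    exact inv_mem (hfs fun h => hx' (((hwy.add_right 1).dvd_iff dvd_rfl).2 h))

theorem genA_pow_mem_residueSubgroup {d : ℕ → ℕ} {p n : ℕ} [NeZero (d n)] (h : p ∣ d n) :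
    genA d n ^ p ∈ residueSubgroup d p n := by
  intro x
  have hpow : genA d n ^ p = rooted (finRotate (d n) ^ (p : ℤ)) := by
    rw [← genA_zpow, zpow_natCast]
  refine ⟨x + (p : ℤ) • 1, ?_, ?_, fun _ => ?_⟩
  · rw [hpow, rooted_apply_single, finRotate_zpow_apply]
  · rw [natCast_zsmul, Fin.val_add, fin_val_nsmul_one, Nat.add_mod_mod]
    show _ % p = _
    rw [Nat.mod_mod_of_dvd _ h, Nat.add_mod_right]
  · rw [hpow, sectionAt_rooted_single]
    exact one_mem _

theorem genB_mem_residueSubgroup {d : ℕ → ℕ} {p n : ℕ} (e : ℕ → ℤ) (h : p ∣ d n) :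
    genB d e n ∈ residueSubgroup d p n := by
  intro x
  refine ⟨x, genB_apply_single e x, rfl, fun hx => ?_⟩
  rw [sectionAt_genB e fun h' => hx (h' ▸ h)]
  exact ⟨_, rfl⟩

namespace IsDefiningData

theorem dvd_pTree (h : IsDefiningData p m e) (n : ℕ) : p ∣ pTree p m n := by
  have : 1 ≤ m (n + 1) := h.pos.trans (h.mono le_rfl (Nat.le_add_left 1 n))
  exact dvd_pow_self p (by omega)

theorem ggs_le_sectionsIn_residueSubgroup (h : IsDefiningData p m e) (he : ¬ NonzeroModP p m e) :
    growingGGS p m e 0 ≤ sectionsIn 0 (residueSubgroup (pTree p m) p 1) := by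
  have : NeZero (pTree p m 1) := ⟨(h.pTree_pos 1).ne'⟩
  rw [growingGGS, ggs_le_sectionsIn_iff]
  intro v
  obtain ⟨x, rfl⟩ := Vertex.single_surjective v
  by_cases hx : x.val + 1 = pTree p m 0
  · rw [sectionAt_genB_last e hx]
    exact genB_mem_residueSubgroup e (h.dvd_pTree 1)
  · rw [sectionAt_genB e hx, dirLabel]
    split_ifs with hlt
    · have hdvd : (p : ℤ) ∣ e (x.val + 1) := by
        by_contra hnd
        refine he ⟨x.val + 1, by omega, Nat.le_sub_one_of_lt hlt, fun h' => hnd ?_⟩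
        exact Int.modEq_zero_iff_dvd.1 h'
      obtain ⟨t, ht⟩ := hdvd
      rw [ht, ← genA_zpow, zpow_mul, zpow_natCast]
      exact zpow_mem (genA_pow_mem_residueSubgroup (h.dvd_pTree 1)) t
    · rw [rooted_eq_one_iff.2 rfl]
      exact one_mem _

/-- `b_2` is not rooted, since a non-zero entry of the defining vector is less in absolute value than
the order of `a_3`. -/
theorem genB_notMem_range_rootedHom (h : IsDefiningData p m e) :
    genB (pTree p m) e 2 ∉ (rootedHom (pTree p m) 2).range := by
  rintro ⟨σ, hσ⟩
  obtain ⟨j, hj1, hj2, hj0⟩ := h.ne_zero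
  have hpos : 0 < p ^ m 1 := h.pTree_pos 0
  have hle : p ^ m 1 ≤ pTree p m 2 := h.pTree_zero_le 2
  have : NeZero (pTree p m 3) := ⟨(h.pTree_pos 3).ne'⟩
  have hlt : j < pTree p m 0 := by
    show j < p ^ m 1
    omega
  let x : Fin (pTree p m 2) := ⟨j - 1, by omega⟩
  have hx : x.val + 1 = j := Nat.sub_add_cancel hj1
  have h1 := sectionAt_rooted_single σ x
  rw [← rootedHom_apply, hσ, sectionAt_genB e (by rw [hx]; omega), hx, rooted_eq_one_iff, dirLabel,
    if_pos hlt, finRotate_zpow_eq_one_iff] at h1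
  have h2 : ((p ^ m 2 : ℕ) : ℤ) ∣ e j :=
    (Int.natCast_dvd_natCast.2 (h.pTree_dvd (show 1 ≤ 3 by omega))).trans h1
  have h3 := h.bound j hj1 hj2
  have h4 := Int.le_of_dvd (abs_pos.2 hj0) ((dvd_abs _ _).2 h2)
  push_cast at h4
  omega

/-- Branching at the first level forces the defining vector to be non-zero modulo `p`: otherwise the
sections of elements of `G_0` preserve residues of letters modulo `p`, in the sense of
`residueSubgroup`, but the commutator `⁅⁅a_1, b_1⁆, a_1 ^ 2⁆` does not. -/
theorem nonzeroModP_of_levelProd_le (h : IsDefiningData p m e)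
    (hle : levelProd 0 (gamma3 (growingGGS p m e 1)) ≤ psiImage (growingGGS p m e 0) 1) :
    NonzeroModP p m e := by
  by_contra he
  set a := genA (pTree p m) 1 with ha
  set b := genB (pTree p m) e 1 with hb
  have hN : 3 < pTree p m 1 := by
    have hm1 := h.pos
    have hm2 : m 1 < m 2 := h.increasing 1 le_rfl
    have hp2 := h.prime.two_le
    calc 3 < 2 ^ 2 := by norm_num
      _ ≤ p ^ 2 := Nat.pow_le_pow_left hp2 2
      _ ≤ p ^ m 2 := Nat.pow_le_pow_right h.prime.pos (by omega)
  have : NeZero (pTree p m 1) := ⟨by omega⟩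
  have hmem : ⁅⁅a, b⁆, a ^ 2⁆ ∈ gamma3 (growingGGS p m e 1) :=
    commutator_mem_gamma3 (Subgroup.commutator_mem_commutator (genA_mem e 1) (genB_mem e 1))
      (pow_mem (genA_mem e 1) 2)
  obtain ⟨f, hf, -, hsec⟩ := mem_psiImage.1
    (hle (mem_levelProd.2 fun _ => hmem : (fun _ => ⁅⁅a, b⁆, a ^ 2⁆) ∈ levelProd 0 _))
  have hres := h.ggs_le_sectionsIn_residueSubgroup he hf (.single ⟨0, h.pTree_pos 0⟩)
  rw [hsec] at hres
  obtain ⟨y, -, -, hroot⟩ := hres 0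
  have hroot := hroot fun h' => by
    have : p ∣ 1 := by simpa using h'
    exact h.prime.one_lt.ne' (Nat.dvd_one.1 this)
  -- At the letter `0`, only the first of the four conjugates of `b_1` has a section that is not
  -- rooted.
  have hcomm : ⁅⁅a, b⁆, a ^ 2⁆ = (a ^ (1 : ℤ) * b * (a ^ (1 : ℤ))⁻¹) *
      (a ^ (0 : ℤ) * b * (a ^ (0 : ℤ))⁻¹)⁻¹ * (a ^ (2 : ℤ) * b * (a ^ (2 : ℤ))⁻¹) *
      (a ^ (3 : ℤ) * b * (a ^ (3 : ℤ))⁻¹)⁻¹ := by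
    simp only [commutatorElement_def]
    group
  have hfix : ∀ t : ℤ, a ^ t * b * (a ^ t)⁻¹ ∈ levelStab (pTree p m) 1 2 :=
    fun t => conj_genB_mem_levelStab e t
  rw [hcomm, sectionAt_mul, sectionAt_mul, sectionAt_mul, sectionAt_inv, sectionAt_inv,
    inv_mem (hfix 3), hfix 2, inv_mem (hfix 0), ha, hb, sectionAt_conj_genB, sectionAt_conj_genB,
    sectionAt_conj_genB, sectionAt_conj_genB] at hroot
  have hother : ∀ t : ℤ, ¬ ((pTree p m 1 : ℕ) : ℤ) ∣ t - 1 →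
      dirTuple (genA (pTree p m) 2) (genB (pTree p m) e 2) (exponents (pTree p m) e 1)
        (t • 1 - 1) 0 ∈ (rootedHom (pTree p m) 2).range := by
    intro t ht
    rw [dirTuple_of_ne]
    · exact Subgroup.zpow_mem _ (show genA (pTree p m) 2 ∈ (rootedHom (pTree p m) 2).range from ⟨_, rfl⟩) _
    · intro h0
      refine ht ?_
      rw [← finRotate_zpow_eq_one_iff]
      refine Equiv.ext fun x => ?_
      rw [finRotate_zpow_apply, sub_smul, one_smul, ← h0, add_zero, Equiv.Perm.one_apply]
  have hN' : (3 : ℤ) < (pTree p m 1 : ℕ) := by exact_mod_cast hN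
  have hnd : ∀ t : ℤ, t ≠ 1 → 0 ≤ t → t ≤ 3 → ¬ ((pTree p m 1 : ℕ) : ℤ) ∣ t - 1 := by
    intro t h1 h2 h3 hd
    have := Int.eq_zero_of_abs_lt_dvd hd (by rw [abs_lt]; constructor <;> omega)
    omega
  have h0 := hother 0 (hnd 0 (by norm_num) (by norm_num) (by norm_num))
  have h2 := hother 2 (hnd 2 (by norm_num) (by norm_num) (by norm_num))
  have h3 := hother 3 (hnd 3 (by norm_num) (by norm_num) (by norm_num))
  rw [one_smul, sub_self, dirTuple_self, Subgroup.mul_mem_cancel_right _ (inv_mem h3),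
    Subgroup.mul_mem_cancel_right _ h2, Subgroup.mul_mem_cancel_right _ (inv_mem h0)] at hroot
  exact h.genB_notMem_range_rootedHom hroot

end IsDefiningData

end GrowingGGS

open GrowingGGS in
/-- Let `G n` stand for `growingGGS p m e n`, so that `G 0` is the growing GGS-group defined by `p`,
`m`, `e`, and let `b n` stand for `genB (pTree p m) e n`.  The hypothesis on `ψ_1` is indexed so that
it links the groups `G n` and `G (n + 1)`, for `n ≥ 0`. -/
theorem mainTheorem3 (p : ℕ) (m : ℕ → ℕ) (e : ℕ → ℤ) (hpme : IsDefiningData p m e) :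
    -- branching over the third term of the lower central series
    ((∀ n, levelProd n (gamma3 (growingGGS p m e (n + 1))) ≤
          psiImage (gamma3 (growingGGS p m e n)) (n + 1)) →
      (∀ n, 1 ≤ n →
        levelProd 0
            (normalClosureIn (growingGGS p m e n) (genB (pTree p m) e n ^ p ^ m (n + 1)) ⊔
              gamma3 (growingGGS p m e n)) ≤
          psiImage (rigidLevelStab (growingGGS p m e 0) n) n) ∧
      IsBranch (growingGGS p m e 0)) ∧
    -- branching over the derived subgroup
    ((∀ n, levelProd n ⁅growingGGS p m e (n + 1), growingGGS p m e (n + 1)⁆ ≤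
          psiImage ⁅growingGGS p m e n, growingGGS p m e n⁆ (n + 1)) →
      ∀ n, 1 ≤ n →
        levelProd 0
            (Subgroup.zpowers (genB (pTree p m) e n ^ p ^ m (n + 1)) ⊔
              ⁅growingGGS p m e n, growingGGS p m e n⁆) ≤
          psiImage (rigidLevelStab (growingGGS p m e 0) n) n) ∧
    -- the torsion-type condition
    (NonzeroModP p m e → TorsionType p m e →
      (∀ n, psiImage
            (gamma3 (growingGGS p m e n ⊓ levelStab (pTree p m) n (n + 1))) (n + 1) =
          levelProd n (gamma3 (growingGGS p m e (n + 1)))) ∧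
      (∀ n, levelProd n (gamma3 (growingGGS p m e (n + 1))) ≤
          psiImage (gamma3 (growingGGS p m e n)) (n + 1)) ∧
      IsBranch (growingGGS p m e 0)) := by
  -- Either branching hypothesis at the first level makes the defining vector non-zero modulo `p`.
  have hmod : ∀ {F : Subgroup (treeAut (pTree p m) 0)} {K : Subgroup (treeAut (pTree p m) 1)},
      F ≤ growingGGS p m e 0 → gamma3 (growingGGS p m e 1) ≤ K →
      levelProd 0 K ≤ psiImage F 1 → NonzeroModP p m e := by
    intro F K hF hK h
    refine hpme.nonzeroModP_of_levelProd_le (le_trans (fun g hg => ?_)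
      (h.trans (psiImage_mono hF 1)))
    exact mem_levelProd.2 fun u => hK (mem_levelProd.1 hg u)
  refine ⟨fun hF => ?_, fun hF n _ => ?_, fun he ht => ?_⟩
  · have he := hmod (gamma3_le_self _) le_rfl (hF 0)
    exact ⟨fun n _ => hpme.levelProd_normalClosureIn_sup_le he
      (F := fun n => gamma3 (growingGGS p m e n)) (gamma3_le_self _) hF n, hpme.isBranch he hF⟩
  · have he := hmod (commutator_self_le _)
      (Subgroup.commutator_mono (commutator_self_le _) le_rfl) (hF 0)
    have hmain := hpme.levelProd_normalClosureIn_sup_le he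
      (F := fun n => ⁅growingGGS p m e n, growingGGS p m e n⁆) (commutator_self_le _) hF n
    refine le_trans (fun g hg => mem_levelProd.2 fun u => ?_) hmain
    have hz : Subgroup.zpowers (genB (pTree p m) e n ^ p ^ m (n + 1)) ≤
        normalClosureIn (growingGGS p m e n) (genB (pTree p m) e n ^ p ^ m (n + 1)) := by
      rw [Subgroup.zpowers_le]
      exact Subgroup.subset_closure ⟨1, one_mem _, by rw [one_mul, inv_one, mul_one]⟩
    exact SetLike.le_def.1 (sup_le_sup_right hz _) (mem_levelProd.1 hg u)
  · have heq := hpme.psiImage_gamma3_levelStab he ht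
    have hF : ∀ n, levelProd n (gamma3 (growingGGS p m e (n + 1))) ≤
        psiImage (gamma3 (growingGGS p m e n)) (n + 1) := fun n =>
      (heq n).ge.trans (psiImage_mono (gamma3_mono inf_le_left) (n + 1))
    exact ⟨heq, hF, hpme.isBranch he hF⟩
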